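/- For $0\le \ell<1$ let $H^\ell=H^\ell(\mathbb{R})$ be the space of real-valued $g\in L^2(\mathbb{R})$ with $\|g\|_{H^\ell}^2=\int_{\mathbb{R}}(1+4\pi^2\xi^2)^{\ell}|\hat g(\xi)|^2\,d\xi<\infty$, where $\hat g(\xi)=\int_{\mathbb R} e^{-2\pi i x\xi}g(x)\,dx$. Consider the Cauchy problem for the forced, damped Benjamin–Bona–Mahony equation on the line $$u_t-u_{xxt}+u-u_{xx}+uu_x=f,\qquad u(0)=\phi,\qquad x\in\mathbb{R},\ t\ge 0. \tag{1}$$ A solution of (1) in $H^\ell$ is a function $u\in C([0,\infty);H^\ell)$ with $u(0)=\phi$ such that for every Schwartz function $\psi$ and every $t\ge0$ $$\int_{\mathbb R} (u(t)-\phi)(\psi-\psi'')\,dx=\int_0^t\Big(\int_{\mathbb R} f(s)\psi\,dx+\int_{\mathbb R}\tfrac12u(s)^2\psi'\,dx-\int_{\mathbb R} u(s)(\psi-\psi'')\,dx\Big)ds .$$ We say that $\phi$ generates $u$ if $u$ is a solution of (1) in $H^\ell$ and is the only one. Theorem. Let $0\le\ell<1$. There are constants $\delta>0$, $\gamma_0>0$,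 $r>0$, $C_0>0$ depending only on $\ell$, and, for every $R>0$, constants $\gamma_1=\gamma_1(R)>0$ and $C_1=C_1(R)>0$ depending only on $\ell$ and $R$, such that the following holds for every $\theta>0$ and every (strongly measurable) $f:[0,\infty)\to L^2(\mathbb{R})$ with $f(t+\theta)=f(t)$ for all $t\ge0$ and $\sup_{t\ge0}\|f(t)\|_{L^2}\le\delta$. (i) (Periodic solution.) There is an initial datum $\tilde\phi\in H^\ell$ which generates a solution $\tilde u$ with $\tilde u(t+\theta)=\tilde u(t)$ for all $t\ge 0$. This periodic solution is unique: every $\theta$-periodic solution of the equation in $H^\ell$, whatever its initial datum, coincides with $\tilde u$ on $[0,\infty)$. (ii) (Local exponential stability.) Every initial datum $\phi\in H^\ell$ with $\|\phi-\tilde\phi\|_{H^\ell}\le r$ generates a solution $u$, and $$\|u(t)-\tilde u(t)\|_{H^\ell}\le C_0e^{-2\gamma_0t}\|\phi-\tilde\phi\|_{H^\ell}\qquad\text{for all } t\ge0 .$$ (iii) (Global exponential stability.) For every $R>0$, every initial datum $\phi\in H^\ell$ with $\|\phi\|_{H^\ell}\le R$ generates a solution $u$, and $$\|u(t)-\tilde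 u(t)\|_{H^\ell}\le C_1(R)\,e^{-2\gamma_1(R)t}\|\phi-\tilde\phi\|_{H^\ell}\qquad\text{for all } t\ge0 .$$ -/

import Mathlib

open MeasureTheory Filter Topology
open scoped ENNReal FourierTransform SchwartzMap

namespace BBM

/-- The real Hilbert space `L²(ℝ)` of real-valued square-integrable functions. -/
abbrev L2 : Type := Lp ℝ 2 (volume : Measure ℝ)

/-- The Fourier transform `ĝ(ξ) = ∫ e^{-2πixξ} g(x) dx` of `g ∈ L²(ℝ)` (Plancherel extension). -/
noncomputable def fourierL2 (g : L2) : Lp ℂ 2 (volume : Measure ℝ) :=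
  𝓕 (Complex.ofRealCLM.compLp g)

/-- The norm of `H^ℓ(ℝ)`, `ℓ ≥ 0`, with value `∞` exactly for those `g ∈ L²(ℝ)` outside `H^ℓ(ℝ)`:
`‖g‖² = ∫ (1 + (2πξ)²)^ℓ |ĝ(ξ)|² dξ`. The factor `2π` accounts for the normalization of the
Fourier transform, so that `‖g‖_{H^1}² = ‖g‖² + ‖g'‖²`. -/
noncomputable def sobolevNorm (ℓ : ℝ) (g : L2) : ℝ≥0∞ :=
  (∫⁻ ξ : ℝ, ENNReal.ofReal ((1 + (2 * Real.pi * ξ) ^ 2) ^ ℓ) * ‖fourierL2 g ξ‖ₑ ^ 2) ^ (1 / 2 : ℝ)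

/-- Membership in `H^ℓ(ℝ)`, for `ℓ ≥ 0`. -/
def MemH (ℓ : ℝ) (g : L2) : Prop := sobolevNorm ℓ g < ∞

/-- `u` is a solution in `H^ℓ(ℝ)`, on the time interval `[0, ∞)`, of the Cauchy problem
`u_t - u_xxt + u - u_xx + u u_x = f`, `u(0) = φ`: it is a continuous curve `[0, ∞) → H^ℓ(ℝ)`,
and the equation, integrated over `[0, t]`, holds in the sense of (tempered) distributions in `x`
for every `t ≥ 0`. Only the values of `u` and `f` at times `t ≥ 0` matter. -/
structure IsSolution (ℓ : ℝ) (f : ℝ → L2) (φ : L2) (u : ℝ → L2) : Prop where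
  memH : ∀ t : ℝ, 0 ≤ t → MemH ℓ (u t)
  cont : ∀ t₀ : ℝ, 0 ≤ t₀ →
    Tendsto (fun t => sobolevNorm ℓ (u t - u t₀)) (𝓝[Set.Ici 0] t₀) (𝓝 0)
  init : u 0 = φ
  weak : ∀ ψ : 𝓢(ℝ, ℝ), ∀ t : ℝ, 0 ≤ t →
    (∫ x : ℝ, u t x * (ψ x - deriv (deriv ψ) x)) - (∫ x : ℝ, u 0 x * (ψ x - deriv (deriv ψ) x)) =
      ∫ s in (0 : ℝ)..t,
        ((∫ x : ℝ, f s x * ψ x) + (∫ x : ℝ, (u s x) ^ 2 / 2 * deriv ψ x)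
          - ∫ x : ℝ, u s x * (ψ x - deriv (deriv ψ) x))

/-- The initial datum `φ` generates `u`: `u` is a solution with `u(0) = φ`, and it is the only one
on `[0, ∞)`. -/
def Generates (ℓ : ℝ) (f : ℝ → L2) (φ : L2) (u : ℝ → L2) : Prop :=
  IsSolution ℓ f φ u ∧ ∀ v : ℝ → L2, IsSolution ℓ f φ v → ∀ t : ℝ, 0 ≤ t → v t = u t

/-- `g` is periodic with period `θ` on the time interval `[0, ∞)`. -/
def PeriodicOnNonneg (θ : ℝ) (g : ℝ → L2) : Prop := ∀ t : ℝ, 0 ≤ t → g (t + θ) = g t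

end BBM

/-!
Applying `(1 - ∂²)⁻¹`, the equation becomes an ordinary differential equation in `L²(ℝ)`,
`u' = -u - ½ B(u, u) + (1 - ∂²)⁻¹ f`, where `B(u, v) = ∂ (1 - ∂²)⁻¹ (u v)` (`bilin`) is a bounded
bilinear map, since its kernel is integrable and bounded. The functions `ψ - ψ''`, `ψ` Schwartz,
are dense in `L²`, so weak solutions are exactly the solutions of the integrated equation in `L²`
(`IsSolution.isMild`, `IsMild.isSolution`), and these are unique by Gronwall (`IsMild.unique`).

The space `H¹` is the image of `L²` under the isometry `P = (1 + ∂)⁻¹` (`resolvent`). The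
substitution `u = P η` turns `B(a, u)` into a bounded bilinear map of `(a, η)` (`lifted`,
`bilin_resolvent`), and the conservation of the `H¹` norm by the nonlinearity into
`⟨η, lifted (P η) η⟩ = 0` (`inner_lifted_self`). For a small forcing, a contraction argument on
bounded continuous curves gives a small `η` with `η(θ) = η(0)` (`exists_isMild_periodic`), and
`u' = P η` is periodic by uniqueness.

The deviation from `u'` of the solution with datum `φ = φ' + w` is only as regular as `w`, for
which there is no energy estimate. But its irregular part is explicit: it is
`a(t) = e^{-t} w + (e^{-2t} - e^{-t}) ½ B(w, w)` (`roughPart`), which satisfies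
`a' = -a - ½ e^{-2t} B(w, w)`. What remains has the form `P z`, where `z` solves a quadratic
equation in `L²` with `z(0) = 0` and a forcing of size `O(‖w‖ e^{-t})`, because in all its terms one
factor is bounded (`resolvent_smoothField`). Since the quadratic term is conservative and `u'` is
small, the energy estimate gives global existence and `‖z(t)‖ ≤ C ‖w‖ e^{-t/2}`
(`exists_decaying_solution`). Finally `‖P z‖_{H^ℓ} ≤ ‖z‖_{L²}` (`sobolevNorm_resolvent_le`), and
`‖B(w, w)‖_{H^ℓ} ≤ 8 ‖w‖_{H^ℓ} ‖w‖_{L²}` (`sobolevNorm_bilin_self_le`), which follows from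
`⟨ξ⟩^ℓ ≤ 2 (⟨η⟩^ℓ + ⟨ξ - η⟩^ℓ)` on the Fourier side. Together they bound the deviation in `H^ℓ` by
`C(R) e^{-t/2} ‖w‖_{H^ℓ}` for all data of norm at most `R`
(`exists_generates_sobolevNorm_sub_le`). The local statement is the case of a ball around `φ'`, and
a second periodic solution would have to approach the first one (`eq_of_periodicOnNonneg`).
-/

namespace BBM

/-! ### Convolution with a kernel bounded by one and of mass at most one -/

/-- A measurable convolution kernel `κ` on the line with `‖κ‖_∞ ≤ 1` and `‖κ‖_{L¹} ≤ 1`. -/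
structure UnitKernel (κ : ℝ → ℝ) : Prop where
  measurable : Measurable κ
  enorm_le_one : ∀ s, ‖κ s‖ₑ ≤ 1
  lintegral_le_one : ∫⁻ s, ‖κ s‖ₑ ≤ 1

namespace UnitKernel

variable {κ : ℝ → ℝ}

lemma integrable (hκ : UnitKernel κ) : Integrable κ :=
  ⟨hκ.measurable.aestronglyMeasurable, hκ.lintegral_le_one.trans_lt ENNReal.one_lt_top⟩

lemma comp_neg (hκ : UnitKernel κ) : UnitKernel fun s => κ (-s) where
  measurable := hκ.measurable.comp measurable_neg
  enorm_le_one s := hκ.enorm_le_one (-s)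
  lintegral_le_one := by
    rw [lintegral_neg_eq_self (fun s => ‖κ s‖ₑ)]; exact hκ.lintegral_le_one

lemma half_sub {κ' : ℝ → ℝ} (hκ : UnitKernel κ) (hκ' : UnitKernel κ') :
    UnitKernel fun s => (κ s - κ' s) / 2 := by
  have key : ∀ s, ‖(κ s - κ' s) / 2‖ₑ ≤ (‖κ s‖ₑ + ‖κ' s‖ₑ) * 2⁻¹ := fun s => by
    rw [div_eq_mul_inv, enorm_mul]
    refine mul_le_mul' enorm_sub_le (le_of_eq ?_)
    rw [enorm_inv (by norm_num)]; norm_num [Real.enorm_eq_ofReal_abs]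
  refine ⟨(hκ.measurable.sub hκ'.measurable).div_const 2, fun s => (key s).trans ?_,
    (lintegral_mono key).trans ?_⟩
  · calc _ ≤ ((1 : ℝ≥0∞) + 1) * 2⁻¹ := by
          gcongr; exacts [hκ.enorm_le_one s, hκ'.enorm_le_one s]
      _ = 1 := by rw [one_add_one_eq_two]; exact ENNReal.mul_inv_cancel (by simp) (by simp)
  · rw [lintegral_mul_const' _ _ (by simp),
      lintegral_add_left hκ.measurable.enorm]
    calc _ ≤ ((1 : ℝ≥0∞) + 1) * 2⁻¹ := by
          gcongr; exacts [hκ.lintegral_le_one, hκ'.lintegral_le_one]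
      _ = 1 := by rw [one_add_one_eq_two]; exact ENNReal.mul_inv_cancel (by simp) (by simp)

end UnitKernel

/-- The convolution `∫ κ(x - y) h(y) dy`. -/
noncomputable def conv (κ h : ℝ → ℝ) (x : ℝ) : ℝ := ∫ y, κ (x - y) * h y

/-- The convolution `∫ |κ(x - y)| |h(y)| dy` of the absolute values. -/
noncomputable def absConv (κ h : ℝ → ℝ) (x : ℝ) : ℝ≥0∞ := ∫⁻ y, ‖κ (x - y)‖ₑ * ‖h y‖ₑ

section

variable {κ h : ℝ → ℝ}

lemma enorm_conv_le (κ h : ℝ → ℝ) (x : ℝ) : ‖conv κ h x‖ₑ ≤ absConv κ h x := by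
  refine (enorm_integral_le_lintegral_enorm _).trans (le_of_eq ?_)
  simp only [absConv, enorm_mul]

lemma conv_congr_ae {h' : ℝ → ℝ} (hh : h =ᵐ[volume] h') : conv κ h = conv κ h' := by
  ext x
  exact integral_congr_ae (hh.mono fun y hy => by simp only [hy])

lemma aestronglyMeasurable_kernel (hκ : UnitKernel κ)
    (hh : AEStronglyMeasurable h) :
    AEStronglyMeasurable (fun p : ℝ × ℝ => κ (p.1 - p.2) * h p.2) (volume.prod volume) :=
  (hκ.measurable.comp (measurable_fst.sub measurable_snd)).aestronglyMeasurable.mul hh.comp_snd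

lemma aestronglyMeasurable_conv (hκ : UnitKernel κ) (hh : AEStronglyMeasurable h) :
    AEStronglyMeasurable (conv κ h) :=
  (aestronglyMeasurable_kernel hκ hh).integral_prod_right'

lemma lintegral_kernel_right (hκ : UnitKernel κ) (x : ℝ) : ∫⁻ y, ‖κ (x - y)‖ₑ ≤ 1 := by
  rw [lintegral_sub_left_eq_self (fun s => ‖κ s‖ₑ) x]; exact hκ.lintegral_le_one

lemma lintegral_kernel_left (hκ : UnitKernel κ) (y : ℝ) : ∫⁻ x, ‖κ (x - y)‖ₑ ≤ 1 := by
  rw [lintegral_sub_right_eq_self (fun s => ‖κ s‖ₑ) y]; exact hκ.lintegral_le_one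

lemma lintegral_absConv_le (hκ : UnitKernel κ) {g : ℝ → ℝ≥0∞} (hg : AEMeasurable g) :
    ∫⁻ x, ∫⁻ y, ‖κ (x - y)‖ₑ * g y ≤ ∫⁻ y, g y := by
  rw [lintegral_lintegral_swap]
  · refine lintegral_mono fun y => ?_
    rw [lintegral_mul_const _ (by have := hκ.measurable; fun_prop)]
    exact mul_le_of_le_one_left' (lintegral_kernel_left hκ y)
  · exact (hκ.measurable.comp (measurable_fst.sub measurable_snd)).enorm.aemeasurable.mul
      hg.comp_snd

lemma absConv_le_lintegral (hκ : UnitKernel κ) (x : ℝ) : absConv κ h x ≤ ∫⁻ y, ‖h y‖ₑ :=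
  lintegral_mono fun _ => mul_le_of_le_one_left' (hκ.enorm_le_one _)

lemma sq_absConv_le (hκ : UnitKernel κ) (hh : AEStronglyMeasurable h) (x : ℝ) :
    absConv κ h x ^ 2 ≤ ∫⁻ y, ‖κ (x - y)‖ₑ * ‖h y‖ₑ ^ 2 := by
  have hm : Measurable fun y => ‖κ (x - y)‖ₑ := by have := hκ.measurable; fun_prop
  have hsq : ∀ a : ℝ≥0∞, (a ^ (1 / 2 : ℝ)) ^ (2 : ℝ) = a := fun a => by
    rw [← ENNReal.rpow_mul]; norm_num
  have h1 := ENNReal.lintegral_mul_le_Lp_mul_Lq volume Real.HolderConjugate.two_two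
    (f := fun y => ‖κ (x - y)‖ₑ ^ (1 / 2 : ℝ)) (g := fun y => ‖κ (x - y)‖ₑ ^ (1 / 2 : ℝ) * ‖h y‖ₑ)
    (hm.pow_const _).aemeasurable ((hm.pow_const _).aemeasurable.mul hh.enorm)
  have h2 : absConv κ h x = ∫⁻ y, ((fun y => ‖κ (x - y)‖ₑ ^ (1 / 2 : ℝ)) *
      fun y => ‖κ (x - y)‖ₑ ^ (1 / 2 : ℝ) * ‖h y‖ₑ) y := by
    refine lintegral_congr fun y => ?_
    simp only [Pi.mul_apply]
    rw [← mul_assoc, ← ENNReal.rpow_add_of_nonneg _ _ (by norm_num) (by norm_num)]; norm_num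
  rw [← h2] at h1
  simp only [hsq, ENNReal.mul_rpow_of_nonneg _ _ (zero_le_two (α := ℝ))] at h1
  calc absConv κ h x ^ 2 ≤ _ := pow_le_pow_left' h1 2
    _ = (∫⁻ y, ‖κ (x - y)‖ₑ) * ∫⁻ y, ‖κ (x - y)‖ₑ * ‖h y‖ₑ ^ (2 : ℝ) := by
      rw [mul_pow, ← ENNReal.rpow_natCast, ← ENNReal.rpow_natCast, ← ENNReal.rpow_mul,
        ← ENNReal.rpow_mul]; norm_num
    _ ≤ _ := by
      refine (mul_le_of_le_one_left' (lintegral_kernel_right hκ x)).trans (le_of_eq ?_)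
      simp only [ENNReal.rpow_two]

lemma le_of_sq_le_sq {a b : ℝ≥0∞} (h : a ^ 2 ≤ b ^ 2) : a ≤ b :=
  (ENNReal.pow_right_strictMono (by norm_num : (2 : ℕ) ≠ 0)).le_iff_le.1 h

lemma eLpNorm_two_sq {F : Type*} [NormedAddCommGroup F] (h : ℝ → F) :
    eLpNorm h 2 volume ^ 2 = ∫⁻ y, ‖h y‖ₑ ^ 2 := by
  rw [eLpNorm_eq_lintegral_rpow_enorm_toReal (by norm_num) (by norm_num)]
  rw [← ENNReal.rpow_natCast, ← ENNReal.rpow_mul]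
  norm_num

lemma absConv_le_eLpNorm_two (hκ : UnitKernel κ) (hh : AEStronglyMeasurable h) (x : ℝ) :
    absConv κ h x ≤ eLpNorm h 2 volume := by
  refine le_of_sq_le_sq ?_
  rw [eLpNorm_two_sq]
  exact (sq_absConv_le hκ hh x).trans
    (lintegral_mono fun y => mul_le_of_le_one_left' (hκ.enorm_le_one _))

lemma eLpNorm_conv_two_two (hκ : UnitKernel κ) (hh : AEStronglyMeasurable h) :
    eLpNorm (conv κ h) 2 volume ≤ eLpNorm h 2 volume := by
  refine le_of_sq_le_sq ?_
  rw [eLpNorm_two_sq, eLpNorm_two_sq]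
  calc _ ≤ ∫⁻ x, ∫⁻ y, ‖κ (x - y)‖ₑ * ‖h y‖ₑ ^ 2 := lintegral_mono fun x =>
        (pow_le_pow_left' (enorm_conv_le κ h x) 2).trans (sq_absConv_le hκ hh x)
    _ ≤ _ := lintegral_absConv_le hκ (hh.enorm.pow_const 2)

lemma eLpNorm_conv_one_two (hκ : UnitKernel κ) (hh : AEStronglyMeasurable h) :
    eLpNorm (conv κ h) 2 volume ≤ eLpNorm h 1 volume := by
  refine le_of_sq_le_sq ?_
  rw [eLpNorm_two_sq, eLpNorm_one_eq_lintegral_enorm]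
  have hm : AEMeasurable (absConv κ h) := by
    have := (aestronglyMeasurable_kernel hκ hh).enorm.lintegral_prod_right'
    simpa only [enorm_mul, absConv] using! this
  calc _ ≤ ∫⁻ x, (∫⁻ y, ‖h y‖ₑ) * absConv κ h x := lintegral_mono fun x => by
        refine (pow_le_pow_left' (enorm_conv_le κ h x) 2).trans ?_
        rw [sq]
        exact mul_le_mul_left (absConv_le_lintegral hκ x) _
    _ = (∫⁻ y, ‖h y‖ₑ) * ∫⁻ x, absConv κ h x := lintegral_const_mul'' _ hm
    _ ≤ _ := by rw [sq]; exact mul_le_mul_right (lintegral_absConv_le hκ hh.enorm) _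

end

/-- Exponents `p` for which `L^p`-functions are convolved with unit kernels: `1` and `2`. -/
class ConvExponent (p : ℝ≥0∞) : Prop where
  eq_one_or_two : p = 1 ∨ p = 2

/-- Exponents `q` such that convolution with a unit kernel maps `L¹` and `L²` to `L^q`:
`2` and `∞`. -/
class ConvTarget (q : ℝ≥0∞) : Prop where
  eq_two_or_top : q = 2 ∨ q = ∞

instance : ConvExponent 1 := ⟨Or.inl rfl⟩
instance : ConvExponent 2 := ⟨Or.inr rfl⟩
instance : ConvTarget 2 := ⟨Or.inl rfl⟩
instance : ConvTarget ∞ := ⟨Or.inr rfl⟩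

section

variable {κ h : ℝ → ℝ} {p q : ℝ≥0∞} [ConvExponent p] [ConvTarget q]

variable (p) in
lemma absConv_le (hκ : UnitKernel κ) (hh : AEStronglyMeasurable h) (x : ℝ) :
    absConv κ h x ≤ eLpNorm h p volume := by
  obtain rfl | rfl := ConvExponent.eq_one_or_two (p := p)
  · rw [eLpNorm_one_eq_lintegral_enorm]; exact absConv_le_lintegral hκ x
  · exact absConv_le_eLpNorm_two hκ hh x

lemma integrable_kernel_mul (hκ : UnitKernel κ) (hh : MemLp h p) (x : ℝ) :
    Integrable fun y => κ (x - y) * h y := by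
  refine ⟨((hκ.measurable.comp (measurable_const.sub measurable_id)).aestronglyMeasurable).mul
    hh.1, ?_⟩
  have := (absConv_le p hκ hh.1 x).trans_lt hh.2
  simpa only [HasFiniteIntegral, enorm_mul, absConv] using! this

variable (p q) in
lemma eLpNorm_conv_le (hκ : UnitKernel κ) (hh : AEStronglyMeasurable h) :
    eLpNorm (conv κ h) q volume ≤ eLpNorm h p volume := by
  obtain rfl | rfl := ConvTarget.eq_two_or_top (q := q)
  · obtain rfl | rfl := ConvExponent.eq_one_or_two (p := p)
    exacts [eLpNorm_conv_one_two hκ hh, eLpNorm_conv_two_two hκ hh]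
  · rw [eLpNorm_exponent_top]
    exact eLpNormEssSup_le_of_ae_enorm_bound
      (ae_of_all _ fun x => (enorm_conv_le κ h x).trans (absConv_le p hκ hh x))

lemma memLp_conv (hκ : UnitKernel κ) (hh : MemLp h p) : MemLp (conv κ h) q :=
  ⟨aestronglyMeasurable_conv hκ hh.1, (eLpNorm_conv_le p q hκ hh.1).trans_lt hh.2⟩

variable (p q) [Fact (1 ≤ p)] [Fact (1 ≤ q)]

/-- Convolution with a unit kernel, as a contraction from `L^p` to `L^q`. -/
noncomputable def convCLM (hκ : UnitKernel κ) :
    Lp ℝ p (volume : Measure ℝ) →L[ℝ] Lp ℝ q (volume : Measure ℝ) :=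
  LinearMap.mkContinuous
    { toFun := fun h => (memLp_conv (q := q) hκ (Lp.memLp h)).toLp
      map_add' := fun g h => by
        rw [← MemLp.toLp_add]
        refine MemLp.toLp_congr _ _ (ae_of_all _ fun x => ?_)
        rw [conv_congr_ae (Lp.coeFn_add g h), Pi.add_apply, conv, conv, conv,
          ← integral_add (integrable_kernel_mul hκ (Lp.memLp g) x)
            (integrable_kernel_mul hκ (Lp.memLp h) x)]
        simp only [Pi.add_apply, mul_add]
      map_smul' := fun c h => by
        rw [RingHom.id_apply, ← MemLp.toLp_const_smul]
        refine MemLp.toLp_congr _ _ (ae_of_all _ fun x => ?_)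
        rw [conv_congr_ae (Lp.coeFn_smul c h), Pi.smul_apply, conv, conv, smul_eq_mul,
          ← integral_const_mul]
        refine integral_congr_ae (ae_of_all _ fun y => ?_)
        simp only [Pi.smul_apply, smul_eq_mul]; ring } 1 fun h => by
    rw [one_mul]
    change ‖(memLp_conv (q := q) hκ (Lp.memLp h)).toLp‖ ≤ ‖h‖
    rw [Lp.norm_toLp, Lp.norm_def]
    exact ENNReal.toReal_mono (Lp.eLpNorm_ne_top h)
      (eLpNorm_conv_le p q hκ (Lp.aestronglyMeasurable h))

variable {p} in
lemma coeFn_convCLM (hκ : UnitKernel κ) (h : Lp ℝ p (volume : Measure ℝ)) :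
    convCLM p q hκ h =ᵐ[volume] conv κ h :=
  MemLp.coeFn_toLp (memLp_conv (q := q) hκ (Lp.memLp h))

variable {p} in
lemma norm_convCLM_apply_le (hκ : UnitKernel κ) (h : Lp ℝ p (volume : Measure ℝ)) :
    ‖convCLM p q hκ h‖ ≤ ‖h‖ := by
  simpa only [one_mul] using
    (convCLM p q hκ).le_of_opNorm_le (LinearMap.mkContinuous_norm_le _ zero_le_one _) h

end

/-- The transpose of convolution with `κ` is convolution with the reflected kernel. -/
lemma integral_conv_mul {κ h χ : ℝ → ℝ} (p : ℝ≥0∞) [ConvExponent p] (hκ : UnitKernel κ)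
    (hh : MemLp h p) (hχ : Integrable χ) :
    ∫ x, conv κ h x * χ x = ∫ y, h y * conv (fun s => κ (-s)) χ y := by
  have hint : Integrable (fun q : ℝ × ℝ => κ (q.1 - q.2) * h q.2 * χ q.1)
      (volume.prod volume) := by
    have hm : AEStronglyMeasurable (fun q : ℝ × ℝ => κ (q.1 - q.2) * h q.2 * χ q.1)
        (volume.prod volume) :=
      (aestronglyMeasurable_kernel hκ hh.1).mul (hχ.1.comp_fst (ν := volume))
    refine ⟨hm, ?_⟩
    rw [HasFiniteIntegral, lintegral_prod _ hm.enorm]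
    calc _ ≤ ∫⁻ x, eLpNorm h p volume * ‖χ x‖ₑ := lintegral_mono fun x => by
          simp only [enorm_mul]
          rw [lintegral_mul_const' _ _ enorm_ne_top]
          exact mul_le_mul_left (absConv_le p hκ hh.1 x) _
      _ = eLpNorm h p volume * ∫⁻ x, ‖χ x‖ₑ := lintegral_const_mul' _ _ hh.2.ne
      _ < ∞ := ENNReal.mul_lt_top hh.2 hχ.2
  calc ∫ x, conv κ h x * χ x = ∫ x, ∫ y, κ (x - y) * h y * χ x := by
        simp only [conv, integral_mul_const]
    _ = ∫ y, ∫ x, κ (x - y) * h y * χ x := integral_integral_swap hint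
    _ = _ := by
      refine integral_congr_ae (ae_of_all _ fun y => ?_)
      simp only [conv, ← integral_const_mul]
      refine integral_congr_ae (ae_of_all _ fun x => ?_)
      simp only [neg_sub]; ring

/-! ### The resolvents of the derivative -/

/-- The kernel `e^{-s} 1_{s > 0}` of `(1 + ∂)⁻¹`. -/
noncomputable def expKernel (s : ℝ) : ℝ := Set.indicator (Set.Ioi 0) (fun s => Real.exp (-s)) s

lemma unitKernel_expKernel : UnitKernel expKernel where
  measurable := (Real.measurable_exp.comp measurable_neg).indicator measurableSet_Ioi
  enorm_le_one s := by
    rw [expKernel, enorm_indicator_eq_indicator_enorm]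
    refine Set.indicator_le (s := Set.Ioi 0) (g := fun _ => (1 : ℝ≥0∞))
      (fun s hs => ?_) s |>.trans ?_
    · rw [Real.enorm_eq_ofReal (Real.exp_pos _).le, ENNReal.ofReal_le_one, Real.exp_le_one_iff]
      have : 0 < s := hs
      linarith
    · exact le_rfl
  lintegral_le_one := by
    simp only [expKernel, enorm_indicator_eq_indicator_enorm]
    rw [lintegral_indicator measurableSet_Ioi]
    simp only [Real.enorm_eq_ofReal (Real.exp_pos _).le]
    rw [← ofReal_integral_eq_lintegral_ofReal, integral_exp_neg_Ioi_zero, ENNReal.ofReal_one]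
    · exact integrableOn_exp_neg_Ioi 0
    · exact ae_of_all _ fun s => (Real.exp_pos _).le

/-- The derivative of a real Schwartz function. -/
noncomputable abbrev sderiv (ψ : 𝓢(ℝ, ℝ)) : 𝓢(ℝ, ℝ) := SchwartzMap.derivCLM ℝ ℝ ψ

/-- `ψ ↦ ψ - ψ''` on real Schwartz functions. -/
noncomputable def bessel (ψ : 𝓢(ℝ, ℝ)) : 𝓢(ℝ, ℝ) := ψ - sderiv (sderiv ψ)

lemma bessel_apply (ψ : 𝓢(ℝ, ℝ)) (x : ℝ) : bessel ψ x = ψ x - deriv (deriv ψ) x := rfl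

lemma tendsto_exp_mul_schwartz (ψ : 𝓢(ℝ, ℝ)) {l : Filter ℝ} {g : ℝ → ℝ}
    (hg : Tendsto g l atBot) : Tendsto (fun y => Real.exp (g y) * ψ y) l (𝓝 0) := by
  obtain ⟨C, hC⟩ : ∃ C, ∀ y, ‖ψ y‖ ≤ C := ⟨_, fun y => ψ.norm_le_seminorm ℝ y⟩
  refine (Real.tendsto_exp_atBot.comp hg).zero_mul_isBoundedUnder_le ?_
  exact ⟨C, eventually_map.2 (Eventually.of_forall hC)⟩

/-- `(1 + ∂)⁻¹ (ψ + ψ') = ψ`. -/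
lemma conv_expKernel_add_deriv (ψ : 𝓢(ℝ, ℝ)) : conv expKernel ⇑(ψ + sderiv ψ) = ψ := by
  ext x
  have hint := integrable_kernel_mul (p := 1) unitKernel_expKernel
    (memLp_one_iff_integrable.2 (ψ + sderiv ψ).integrable) x
  have key : ∀ y, expKernel (x - y) * (ψ + sderiv ψ) y = Set.indicator (Set.Iio x)
      (fun y => Real.exp (y - x) * ψ y + Real.exp (y - x) * deriv ψ y) y := fun y => by
    by_cases h : y < x
    · rw [expKernel, Set.indicator_of_mem (by simpa using h),
        Set.indicator_of_mem (by simpa using h)]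
      simp only [_root_.add_apply, SchwartzMap.derivCLM_apply, neg_sub]; ring
    · rw [expKernel, Set.indicator_of_notMem (by simpa using h),
        Set.indicator_of_notMem (by simpa using h), zero_mul]
  simp only [conv, key] at hint ⊢
  rw [integral_indicator measurableSet_Iio, ← integral_Iic_eq_integral_Iio,
    integral_Iic_of_hasDerivAt_of_tendsto' (f := fun y => Real.exp (y - x) * ψ y) (m := 0)]
  · simp
  · intro y _
    have h1 : HasDerivAt (fun y => Real.exp (y - x)) (Real.exp (y - x)) y := by
      simpa using ((hasDerivAt_id y).sub_const x).exp
    exact h1.mul (ψ.hasDerivAt y)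
  · rw [integrableOn_Iic_iff_integrableOn_Iio]
    exact (integrable_indicator_iff measurableSet_Iio).1 hint
  · exact tendsto_exp_mul_schwartz ψ (tendsto_atBot_add_const_right _ (-x) tendsto_id)

/-- `(1 - ∂)⁻¹ (ψ - ψ') = ψ`. -/
lemma conv_expKernel_neg_sub_deriv (ψ : 𝓢(ℝ, ℝ)) :
    conv (fun s => expKernel (-s)) ⇑(ψ - sderiv ψ) = ψ := by
  ext x
  have hint := integrable_kernel_mul (p := 1) unitKernel_expKernel.comp_neg
    (memLp_one_iff_integrable.2 (ψ - sderiv ψ).integrable) x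
  have key : ∀ y, expKernel (-(x - y)) * (ψ - sderiv ψ) y = Set.indicator (Set.Ioi x)
      (fun y => -(-Real.exp (x - y) * ψ y + Real.exp (x - y) * deriv ψ y)) y := fun y => by
    by_cases h : x < y
    · rw [expKernel, Set.indicator_of_mem (by simpa using h),
        Set.indicator_of_mem (by simpa using h)]
      simp only [_root_.sub_apply, SchwartzMap.derivCLM_apply, neg_neg]; ring
    · rw [expKernel, Set.indicator_of_notMem (by simpa using h),
        Set.indicator_of_notMem (by simpa using h), zero_mul]
  simp only [conv, key] at hint ⊢
  rw [integral_indicator measurableSet_Ioi,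
    integral_Ioi_of_hasDerivAt_of_tendsto' (f := fun y => -(Real.exp (x - y) * ψ y)) (m := 0)]
  · simp
  · intro y _
    have h1 : HasDerivAt (fun y => Real.exp (x - y)) (-Real.exp (x - y)) y := by
      simpa using ((hasDerivAt_id y).const_sub x).exp
    exact (h1.mul (ψ.hasDerivAt y)).neg
  · exact (integrable_indicator_iff measurableSet_Ioi).1 hint
  · have := (tendsto_exp_mul_schwartz ψ (g := fun y => x - y) (l := atTop)
      (tendsto_atBot_add_const_left _ x tendsto_neg_atTop_atBot)).neg
    simpa using this

/-- `(1 + ∂)⁻¹` on `L²(ℝ)`. It maps `L²(ℝ)` isometrically onto `H¹(ℝ)`. -/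
noncomputable def resolvent : L2 →L[ℝ] L2 := convCLM 2 2 unitKernel_expKernel

/-- `(1 + ∂)⁻¹` as an operator from `L²(ℝ)` to `L^∞(ℝ)`. -/
noncomputable def resolventTop : L2 →L[ℝ] Lp ℝ ∞ (volume : Measure ℝ) :=
  convCLM 2 ∞ unitKernel_expKernel

/-- `(1 - ∂)⁻¹` on `L²(ℝ)`. -/
noncomputable def resolventAdj : L2 →L[ℝ] L2 := convCLM 2 2 unitKernel_expKernel.comp_neg

/-- The kernel `-sgn(s) e^{-|s|} / 2` of `∂ (1 - ∂²)⁻¹`. -/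
noncomputable def fluxKernel (s : ℝ) : ℝ := (expKernel (-s) - expKernel s) / 2

lemma unitKernel_fluxKernel : UnitKernel fluxKernel :=
  unitKernel_expKernel.comp_neg.half_sub unitKernel_expKernel

/-- `∂ (1 - ∂²)⁻¹` as an operator from `L¹(ℝ)` to `L^q(ℝ)`, `q = 2, ∞`. -/
noncomputable def flux (q : ℝ≥0∞) [ConvTarget q] [Fact (1 ≤ q)] :
    Lp ℝ 1 (volume : Measure ℝ) →L[ℝ] Lp ℝ q (volume : Measure ℝ) :=
  convCLM 1 q unitKernel_fluxKernel

lemma inner_toLp (χ : 𝓢(ℝ, ℝ)) (u : L2) : inner ℝ (χ.toLp 2) u = ∫ x, u x * χ x := by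
  rw [L2.inner_def]
  refine integral_congr_ae ?_
  filter_upwards [χ.coeFn_toLp 2] with x hx
  rw [hx]; simp

lemma inner_resolvent (ψ : 𝓢(ℝ, ℝ)) (u : L2) :
    inner ℝ ((ψ - sderiv ψ).toLp 2) (resolvent u) = inner ℝ (ψ.toLp 2) u := by
  rw [inner_toLp, inner_toLp]
  have h : ∀ᵐ x, resolvent u x * (ψ - sderiv ψ) x = conv expKernel u x * (ψ - sderiv ψ) x :=
    (coeFn_convCLM 2 unitKernel_expKernel u).mono fun x hx => by rw [resolvent, hx]
  rw [integral_congr_ae h, integral_conv_mul 2 unitKernel_expKernel (Lp.memLp u)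
    (ψ - sderiv ψ).integrable, conv_expKernel_neg_sub_deriv]

lemma inner_resolventAdj (ψ : 𝓢(ℝ, ℝ)) (u : L2) :
    inner ℝ ((ψ + sderiv ψ).toLp 2) (resolventAdj u) = inner ℝ (ψ.toLp 2) u := by
  rw [inner_toLp, inner_toLp]
  have h : ∀ᵐ x, resolventAdj u x * (ψ + sderiv ψ) x =
      conv (fun s => expKernel (-s)) u x * (ψ + sderiv ψ) x :=
    (coeFn_convCLM 2 unitKernel_expKernel.comp_neg u).mono fun x hx => by rw [resolventAdj, hx]
  rw [integral_congr_ae h, integral_conv_mul 2 unitKernel_expKernel.comp_neg (Lp.memLp u)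
    (ψ + sderiv ψ).integrable]
  simp only [neg_neg]
  rw [conv_expKernel_add_deriv]

lemma bessel_eq_left (ψ : 𝓢(ℝ, ℝ)) : bessel ψ = (ψ - sderiv ψ) + sderiv (ψ - sderiv ψ) := by
  rw [bessel, sderiv, sderiv, sderiv, map_sub]; abel

lemma bessel_eq_right (ψ : 𝓢(ℝ, ℝ)) : bessel ψ = (ψ + sderiv ψ) - sderiv (ψ + sderiv ψ) := by
  rw [bessel, sderiv, sderiv, sderiv, map_add]; abel

/-- `∂ (1 - ∂²)⁻¹ (ψ - ψ'') = ψ'`. -/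
lemma conv_fluxKernel_bessel (ψ : 𝓢(ℝ, ℝ)) : conv fluxKernel (bessel ψ) = sderiv ψ := by
  ext y
  have e1 := congrFun (conv_expKernel_add_deriv (ψ - sderiv ψ)) y
  have e2 := congrFun (conv_expKernel_neg_sub_deriv (ψ + sderiv ψ)) y
  rw [← bessel_eq_left] at e1
  rw [← bessel_eq_right] at e2
  have i1 := integrable_kernel_mul (p := 1) unitKernel_expKernel
    (memLp_one_iff_integrable.2 (bessel ψ).integrable) y
  have i2 := integrable_kernel_mul (p := 1) unitKernel_expKernel.comp_neg
    (memLp_one_iff_integrable.2 (bessel ψ).integrable) y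
  have e3 : conv fluxKernel (bessel ψ) y =
      (conv (fun s => expKernel (-s)) (bessel ψ) y - conv expKernel (bessel ψ) y) / 2 := by
    rw [conv, conv, conv, ← integral_sub i2 i1, ← integral_div]
    refine integral_congr_ae (ae_of_all _ fun z => ?_)
    simp only [fluxKernel]; ring
  rw [e3, e1, e2]
  simp only [_root_.sub_apply, _root_.add_apply]; ring

lemma inner_bessel_flux (ψ : 𝓢(ℝ, ℝ)) (h : Lp ℝ 1 (volume : Measure ℝ)) :
    inner ℝ ((bessel ψ).toLp 2) (flux 2 h) = -∫ x, h x * deriv ψ x := by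
  rw [inner_toLp]
  have h1 : ∀ᵐ x, flux 2 h x * bessel ψ x = conv fluxKernel h x * bessel ψ x :=
    (coeFn_convCLM 2 unitKernel_fluxKernel h).mono fun x hx => by rw [flux, hx]
  rw [integral_congr_ae h1, integral_conv_mul 1 unitKernel_fluxKernel (Lp.memLp h)
    (bessel ψ).integrable, ← integral_neg]
  refine integral_congr_ae (ae_of_all _ fun y => ?_)
  have : conv (fun s => fluxKernel (-s)) (bessel ψ) y = -deriv ψ y := by
    have e : conv fluxKernel (bessel ψ) y = deriv ψ y :=
      congrFun (conv_fluxKernel_bessel ψ) y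
    rw [← e, conv, conv, ← integral_neg]
    refine integral_congr_ae (ae_of_all _ fun z => ?_)
    simp only [fluxKernel, neg_neg]; ring
  simp only [this]; ring

/-! ### Uniqueness for the weak formulation -/

open LineDeriv in
lemma lineDerivOp_one_eq_derivCLM {F : Type*} [NormedAddCommGroup F] [NormedSpace ℝ F]
    (f : 𝓢(ℝ, F)) : ∂_{(1 : ℝ)} f = SchwartzMap.derivCLM ℝ F f := by
  ext x
  rw [SchwartzMap.lineDerivOp_apply_eq_fderiv, SchwartzMap.derivCLM_apply,
    fderiv_apply_one_eq_deriv]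

lemma sderiv_re (Ψ : 𝓢(ℝ, ℂ)) : sderiv (Ψ.postcompCLM Complex.reCLM) =
    (SchwartzMap.derivCLM ℝ ℂ Ψ).postcompCLM Complex.reCLM := by
  ext x
  simp only [SchwartzMap.derivCLM_apply, SchwartzMap.postcompCLM_apply]
  exact ((Complex.reCLM.hasFDerivAt.comp_hasDerivAt x (Ψ.hasDerivAt x))).deriv

/-- The operator `1 - ∂²` is onto the real Schwartz functions. -/
lemma exists_bessel_eq (χ : 𝓢(ℝ, ℝ)) : ∃ ψ, bessel ψ = χ := by
  set c : 𝓢(ℝ, ℂ) := χ.postcompCLM Complex.ofRealCLM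
  set g : ℝ → ℝ := fun ξ => (1 + ‖2 * Real.pi * ξ‖ ^ 2) ^ (-1 : ℝ)
  have hg : g.HasTemperateGrowth :=
    (Function.hasTemperateGrowth_one_add_norm_sq_rpow ℝ (-1)).comp
      (f := fun ξ : ℝ => 2 * Real.pi * ξ) (by fun_prop)
  set Ψ : 𝓢(ℝ, ℂ) := 𝓕⁻ (SchwartzMap.smulLeftCLM ℂ g (𝓕 c))
  have hΨ : Ψ - SchwartzMap.derivCLM ℝ ℂ (SchwartzMap.derivCLM ℝ ℂ Ψ) = c := by
    have hinj : Function.Injective (𝓕 : 𝓢(ℝ, ℂ) → 𝓢(ℝ, ℂ)) :=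
      (FourierTransform.fourierEquiv ℂ 𝓢(ℝ, ℂ)).injective
    apply hinj
    have h1 : (inner ℝ · (1 : ℝ) : ℝ → ℝ).HasTemperateGrowth := by fun_prop
    ext ξ
    have e : 𝓕 (Ψ - SchwartzMap.derivCLM ℝ ℂ (SchwartzMap.derivCLM ℝ ℂ Ψ)) =
        𝓕 Ψ - 𝓕 (SchwartzMap.derivCLM ℝ ℂ (SchwartzMap.derivCLM ℝ ℂ Ψ)) :=
      map_sub (FourierTransform.fourierEquiv ℂ 𝓢(ℝ, ℂ)) _ _
    rw [e, ← lineDerivOp_one_eq_derivCLM, ← lineDerivOp_one_eq_derivCLM,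
      SchwartzMap.fourier_lineDerivOp_eq, SchwartzMap.fourier_lineDerivOp_eq]
    have e2 : 𝓕 Ψ = SchwartzMap.smulLeftCLM ℂ g (𝓕 c) := FourierTransform.fourier_fourierInv_eq _
    rw [e2]
    simp only [_root_.sub_apply, _root_.smul_apply,
      SchwartzMap.smulLeftCLM_apply_apply h1, SchwartzMap.smulLeftCLM_apply_apply hg]
    have hpos : (0 : ℝ) < 1 + (2 * Real.pi * ξ) ^ 2 := by positivity
    have hgξ : g ξ = (1 + (2 * Real.pi * ξ) ^ 2)⁻¹ := by
      simp only [g, Real.norm_eq_abs, sq_abs, Real.rpow_neg_one]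
    rw [hgξ]
    simp only [Complex.real_smul, smul_eq_mul, RCLike.inner_apply]
    have hne : (1 + (2 * Real.pi * ξ) ^ 2 : ℂ) ≠ 0 := by exact_mod_cast hpos.ne'
    push_cast
    simp only [conj_trivial, one_mul]
    have key : ∀ w F : ℂ, 1 + w ^ 2 ≠ 0 →
        (1 + w ^ 2)⁻¹ * F + w ^ 2 * ((1 + w ^ 2)⁻¹ * F) = F := fun w F hw => by
      field_simp
    linear_combination key (2 * Real.pi * ξ) (𝓕 c ξ) hne -
      ((2 * Real.pi * ξ) ^ 2 * ((1 + (2 * Real.pi * ξ : ℂ) ^ 2)⁻¹ * 𝓕 c ξ)) * Complex.I_sq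
  refine ⟨Ψ.postcompCLM Complex.reCLM, ?_⟩
  rw [bessel, sderiv_re, sderiv_re, ← map_sub, hΨ]
  ext x
  simp [c]

/-- An element of `L²(ℝ)` that is orthogonal to `ψ - ψ''` for all Schwartz `ψ` vanishes. -/
lemma ext_of_inner_bessel {u v : L2}
    (h : ∀ ψ, inner ℝ ((bessel ψ).toLp 2) u = inner ℝ ((bessel ψ).toLp 2) v) : u = v := by
  refine ext_inner_left ℝ fun w => ?_
  refine DenseRange.induction_on (p := fun w => inner ℝ w u = inner ℝ w v)
    (SchwartzMap.denseRange_toLpCLM (E := ℝ) (F := ℝ) (μ := volume) (p := 2)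
      ENNReal.ofNat_ne_top) w ?_ fun χ => ?_
  · exact isClosed_eq (by fun_prop) (by fun_prop)
  · obtain ⟨ψ, rfl⟩ := exists_bessel_eq χ
    exact h ψ

/-- The functions `χ + χ'`, `χ` Schwartz, are dense in `L²(ℝ)`. -/
lemma denseRange_add_deriv : DenseRange fun χ : 𝓢(ℝ, ℝ) => ((χ + sderiv χ).toLp 2 : L2) := by
  refine (SchwartzMap.denseRange_toLpCLM (E := ℝ) (F := ℝ) (μ := volume) (p := 2)
      ENNReal.ofNat_ne_top).mono ?_
  rintro _ ⟨χ, rfl⟩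
  obtain ⟨ψ, rfl⟩ := exists_bessel_eq χ
  exact ⟨ψ - sderiv ψ, by rw [bessel_eq_left]; rfl⟩

/-! ### The quadratic nonlinearity -/

/-- The bounded bilinear map `(u, v) ↦ ∂ (1 - ∂²)⁻¹ (u v)` on `L²(ℝ)`. -/
noncomputable def bilin : L2 →L[ℝ] L2 →L[ℝ] L2 :=
  ((flux 2).postcomp L2) ∘L ((ContinuousLinearMap.mul ℝ ℝ).holderL volume 2 2 1)

/-- The product of a function in `L²(ℝ)` and a bounded function. -/
noncomputable def mulTop : L2 →L[ℝ] Lp ℝ ∞ (volume : Measure ℝ) →L[ℝ] L2 :=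
  (ContinuousLinearMap.mul ℝ ℝ).holderL volume 2 ∞ 2

/-- `∂ (1 + ∂)(1 - ∂²)⁻¹ = (1 - ∂)⁻¹ - 1` on `L²(ℝ)`. -/
noncomputable def liftedFlux : L2 →L[ℝ] L2 := resolventAdj - ContinuousLinearMap.id ℝ L2

/-- The bilinear map `(a, z) ↦ ∂ (1 + ∂)(1 - ∂²)⁻¹ (a (1 + ∂)⁻¹ z)` on `L²(ℝ)`, that is, the
nonlinearity `bilin` read through the isomorphism `(1 + ∂)⁻¹` of `L²(ℝ)` onto `H¹(ℝ)`. -/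
noncomputable def lifted : L2 →L[ℝ] L2 →L[ℝ] L2 :=
  (liftedFlux.postcomp L2) ∘L (resolventTop.precomp L2) ∘L mulTop

lemma bilin_apply (u v : L2) :
    bilin u v = flux 2 ((ContinuousLinearMap.mul ℝ ℝ).holder 1 u v) := rfl

lemma lifted_apply (a z : L2) : lifted a z = liftedFlux (mulTop a (resolventTop z)) := rfl

lemma coeFn_mulTop (a : L2) (b : Lp ℝ ∞ (volume : Measure ℝ)) :
    mulTop a b =ᵐ[volume] fun x => a x * b x :=
  (ContinuousLinearMap.mul ℝ ℝ).coeFn_holder a b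

lemma norm_mul_le : ‖ContinuousLinearMap.mul ℝ ℝ‖ ≤ 1 := ContinuousLinearMap.opNorm_mul_le ℝ ℝ

lemma norm_mulTop_le (a : L2) (b : Lp ℝ ∞ (volume : Measure ℝ)) :
    ‖mulTop a b‖ ≤ ‖a‖ * ‖b‖ := by
  refine ((ContinuousLinearMap.mul ℝ ℝ).norm_holder_apply_apply_le a b).trans ?_
  exact mul_le_mul_of_nonneg_right (mul_le_of_le_one_left (norm_nonneg a) norm_mul_le)
    (norm_nonneg b)

lemma norm_resolvent_le (u : L2) : ‖resolvent u‖ ≤ ‖u‖ := norm_convCLM_apply_le 2 _ u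

lemma norm_resolventTop_le (u : L2) : ‖resolventTop u‖ ≤ ‖u‖ := norm_convCLM_apply_le ∞ _ u

lemma norm_resolventAdj_le (u : L2) : ‖resolventAdj u‖ ≤ ‖u‖ := norm_convCLM_apply_le 2 _ u

lemma norm_liftedFlux_le (u : L2) : ‖liftedFlux u‖ ≤ 2 * ‖u‖ := by
  rw [two_mul]
  exact (norm_sub_le _ _).trans (add_le_add (norm_resolventAdj_le u) le_rfl)

lemma norm_lifted_le (a z : L2) : ‖lifted a z‖ ≤ 2 * (‖a‖ * ‖z‖) := by
  refine (norm_liftedFlux_le _).trans (mul_le_mul_of_nonneg_left ?_ zero_le_two)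
  exact (norm_mulTop_le _ _).trans
    (mul_le_mul_of_nonneg_left (norm_resolventTop_le z) (norm_nonneg a))

lemma norm_flux_le (q : ℝ≥0∞) [ConvTarget q] [Fact (1 ≤ q)] (h : Lp ℝ 1 (volume : Measure ℝ)) :
    ‖flux q h‖ ≤ ‖h‖ := norm_convCLM_apply_le q _ h

lemma norm_holder_one_le (u v : L2) :
    ‖(ContinuousLinearMap.mul ℝ ℝ).holder 1 u v‖ ≤ ‖u‖ * ‖v‖ := by
  refine ((ContinuousLinearMap.mul ℝ ℝ).norm_holder_apply_apply_le u v).trans ?_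
  exact mul_le_mul_of_nonneg_right (mul_le_of_le_one_left (norm_nonneg u) norm_mul_le)
    (norm_nonneg v)

lemma norm_bilin_le (u v : L2) : ‖bilin u v‖ ≤ ‖u‖ * ‖v‖ :=
  (norm_flux_le 2 _).trans (norm_holder_one_le u v)

lemma bilin_comm (u v : L2) : bilin u v = bilin v u := by
  rw [bilin_apply, bilin_apply]
  congr 1
  refine Lp.ext ?_
  filter_upwards [(ContinuousLinearMap.mul ℝ ℝ).coeFn_holder (r := 1) u v,
    (ContinuousLinearMap.mul ℝ ℝ).coeFn_holder (r := 1) v u] with x h1 h2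
  rw [h1, h2, ContinuousLinearMap.mul_apply', ContinuousLinearMap.mul_apply', mul_comm]

lemma inner_bessel_bilin (ψ : 𝓢(ℝ, ℝ)) (u v : L2) :
    inner ℝ ((bessel ψ).toLp 2) (bilin u v) = -∫ x, u x * v x * deriv ψ x := by
  rw [bilin_apply, inner_bessel_flux, neg_inj]
  refine integral_congr_ae ?_
  filter_upwards [(ContinuousLinearMap.mul ℝ ℝ).coeFn_holder (r := 1) u v] with x h1
  rw [h1, ContinuousLinearMap.mul_apply']

lemma inner_add_deriv_liftedFlux (ψ : 𝓢(ℝ, ℝ)) (g : L2) :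
    inner ℝ ((ψ + sderiv ψ).toLp 2) (liftedFlux g) = -∫ x, g x * deriv ψ x := by
  have e : ((ψ + sderiv ψ).toLp 2 volume : L2) =
      ψ.toLp 2 volume + (sderiv ψ).toLp 2 volume := rfl
  have h : liftedFlux g = resolventAdj g - g := rfl
  rw [h, inner_sub_right, inner_resolventAdj, e, inner_add_left, sub_add_cancel_left, inner_toLp]
  rfl

/-- Multiplication followed by `∂ (1 - ∂²)⁻¹` agrees with the `L²`-theory when one factor is
bounded. -/
lemma bilin_eq_of_ae {a v : L2} {b : Lp ℝ ∞ (volume : Measure ℝ)} (h : v =ᵐ[volume] b) :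
    bilin a v = resolvent (liftedFlux (mulTop a b)) := by
  refine ext_of_inner_bessel fun ψ => ?_
  rw [inner_bessel_bilin]
  conv_rhs => rw [bessel_eq_right, inner_resolvent, inner_add_deriv_liftedFlux]
  rw [neg_inj]
  refine integral_congr_ae ?_
  filter_upwards [h, coeFn_mulTop a b] with x h1 h2
  rw [h1, h2]

lemma resolvent_ae_eq_resolventTop (z : L2) : resolvent z =ᵐ[volume] resolventTop z :=
  (coeFn_convCLM 2 unitKernel_expKernel z).trans (coeFn_convCLM ∞ unitKernel_expKernel z).symm

lemma bilin_resolvent (a z : L2) : bilin a (resolvent z) = resolvent (lifted a z) :=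
  bilin_eq_of_ae (resolvent_ae_eq_resolventTop z)

lemma resolvent_add_deriv (χ : 𝓢(ℝ, ℝ)) : resolvent ((χ + sderiv χ).toLp 2) = χ.toLp 2 := by
  refine Lp.ext ((coeFn_convCLM 2 unitKernel_expKernel _).trans ?_)
  rw [conv_congr_ae ((χ + sderiv χ).coeFn_toLp 2), conv_expKernel_add_deriv]
  exact (χ.coeFn_toLp 2).symm

/-- Conservation of the `H¹` norm by the nonlinearity: `∫ v v' v = 0` for `v = (1 + ∂)⁻¹ z`. -/
lemma inner_lifted_self (z : L2) : inner ℝ z (lifted (resolvent z) z) = 0 := by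
  refine DenseRange.induction_on (p := fun z => inner ℝ z (lifted (resolvent z) z) = 0)
    denseRange_add_deriv z (isClosed_eq (by fun_prop) continuous_const) fun χ => ?_
  rw [lifted_apply, inner_add_deriv_liftedFlux, neg_eq_zero, resolvent_add_deriv]
  have h : ∀ᵐ x, mulTop (χ.toLp 2) (resolventTop ((χ + sderiv χ).toLp 2)) x * deriv χ x =
      χ x ^ 2 * deriv χ x := by
    have h0 := resolvent_ae_eq_resolventTop ((χ + sderiv χ).toLp 2)
    rw [resolvent_add_deriv] at h0
    filter_upwards [h0, χ.coeFn_toLp 2, coeFn_mulTop (χ.toLp 2)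
      (resolventTop ((χ + sderiv χ).toLp 2))] with x h1 h2 h3
    rw [h3, ← h1, h2, sq]
  rw [integral_congr_ae h]
  have hd : ∀ x, HasDerivAt (fun x => χ x ^ 3 / 3) (χ x ^ 2 * deriv χ x) x := fun x => by
    refine (((χ.hasDerivAt x).pow 3).div_const 3).congr_deriv ?_
    push_cast; ring
  have hb : ∀ x, ‖χ x‖ ≤ SchwartzMap.seminorm ℝ 0 0 χ := fun x => χ.norm_le_seminorm ℝ x
  refine integral_eq_zero_of_hasDerivAt_of_integrable hd ?_ ?_
  · have hi : Integrable fun x => χ x ^ 2 * sderiv χ x := by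
      refine (sderiv χ).integrable.bdd_mul (c := (SchwartzMap.seminorm ℝ 0 0 χ) ^ 2)
        (χ.continuous.pow 2).aestronglyMeasurable (ae_of_all _ fun x => ?_)
      rw [norm_pow]; exact pow_le_pow_left₀ (norm_nonneg _) (hb x) 2
    exact hi
  · have hi : Integrable fun x => χ x ^ 2 * χ x := by
      refine χ.integrable.bdd_mul (c := (SchwartzMap.seminorm ℝ 0 0 χ) ^ 2)
        (χ.continuous.pow 2).aestronglyMeasurable (ae_of_all _ fun x => ?_)
      rw [norm_pow]; exact pow_le_pow_left₀ (norm_nonneg _) (hb x) 2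
    exact (hi.div_const 3).congr (ae_of_all _ fun x => by simp only; ring)

/-! ### The Sobolev norm -/

/-- The symbol `1 + (2πξ)²` of `1 - ∂²`. -/
noncomputable def japanese (ξ : ℝ) : ℝ := 1 + (2 * Real.pi * ξ) ^ 2

lemma one_le_japanese (ξ : ℝ) : 1 ≤ japanese ξ := by
  rw [japanese]; nlinarith [sq_nonneg (2 * Real.pi * ξ)]

lemma japanese_pos (ξ : ℝ) : 0 < japanese ξ := zero_lt_one.trans_le (one_le_japanese ξ)

lemma measurable_japanese : Measurable japanese := by unfold japanese; fun_prop

lemma ofReal_japanese_rpow (ℓ ξ : ℝ) :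
    ENNReal.ofReal (japanese ξ ^ ℓ) = ENNReal.ofReal (japanese ξ ^ (ℓ / 2)) ^ 2 := by
  rw [← ENNReal.ofReal_pow (Real.rpow_nonneg (japanese_pos ξ).le _), ← Real.rpow_natCast,
    ← Real.rpow_mul (japanese_pos ξ).le]
  norm_num

lemma sobolevNorm_sq (ℓ : ℝ) (g : L2) :
    sobolevNorm ℓ g ^ 2 = ∫⁻ ξ, ENNReal.ofReal (japanese ξ ^ ℓ) * ‖fourierL2 g ξ‖ₑ ^ 2 := by
  rw [sobolevNorm, ← ENNReal.rpow_natCast, ← ENNReal.rpow_mul]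
  norm_num [japanese]

lemma enorm_weight_mul (ℓ ξ : ℝ) (z : ℂ) :
    ‖((japanese ξ ^ (ℓ / 2) : ℝ) : ℂ) * z‖ₑ = ENNReal.ofReal (japanese ξ ^ (ℓ / 2)) * ‖z‖ₑ := by
  rw [enorm_mul]
  congr 1
  rw [← ofReal_norm, Complex.norm_real,
    Real.norm_of_nonneg (Real.rpow_nonneg (japanese_pos ξ).le _)]

lemma sobolevNorm_eq_eLpNorm (ℓ : ℝ) (g : L2) :
    sobolevNorm ℓ g =
      eLpNorm (fun ξ => ((japanese ξ ^ (ℓ / 2) : ℝ) : ℂ) * fourierL2 g ξ) 2 volume := by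
  have e : sobolevNorm ℓ g ^ 2 =
      eLpNorm (fun ξ => ((japanese ξ ^ (ℓ / 2) : ℝ) : ℂ) * fourierL2 g ξ) 2 volume ^ 2 := by
    rw [sobolevNorm_sq, eLpNorm_two_sq]
    refine lintegral_congr fun ξ => ?_
    rw [enorm_weight_mul, mul_pow, ofReal_japanese_rpow]
  exact le_antisymm (le_of_sq_le_sq e.le) (le_of_sq_le_sq e.ge)

/-- The Fourier transform on real `L²` as a real-linear map. -/
noncomputable def fourierCLM : L2 →L[ℝ] Lp ℂ 2 (volume : Measure ℝ) :=
  ((Lp.fourierTransformₗᵢ ℝ ℂ).toContinuousLinearEquiv.toContinuousLinearMap.restrictScalars ℝ) ∘L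
    (Complex.ofRealCLM.compLpL 2 volume)

lemma fourierCLM_apply (g : L2) : fourierCLM g = fourierL2 g := rfl

lemma norm_fourierCLM (g : L2) : ‖fourierCLM g‖ = ‖g‖ := by
  rw [fourierCLM_apply, fourierL2, Lp.norm_fourier_eq, Lp.norm_def, Lp.norm_def]
  refine congrArg _ (eLpNorm_congr_norm_ae ?_)
  filter_upwards [Complex.ofRealCLM.coeFn_compLp g] with x hx
  rw [hx]; simp

lemma aestronglyMeasurable_weight_mul (ℓ : ℝ) (g : L2) :
    AEStronglyMeasurable fun ξ => ((japanese ξ ^ (ℓ / 2) : ℝ) : ℂ) * fourierL2 g ξ := by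
  refine AEStronglyMeasurable.mul ?_ (Lp.aestronglyMeasurable _)
  exact (Complex.measurable_ofReal.comp (measurable_japanese.pow_const _)).aestronglyMeasurable

lemma sobolevNorm_add_le (ℓ : ℝ) (g h : L2) :
    sobolevNorm ℓ (g + h) ≤ sobolevNorm ℓ g + sobolevNorm ℓ h := by
  simp only [sobolevNorm_eq_eLpNorm]
  refine le_trans (le_of_eq (eLpNorm_congr_ae ?_)) (eLpNorm_add_le
    (aestronglyMeasurable_weight_mul ℓ g) (aestronglyMeasurable_weight_mul ℓ h) (by norm_num))
  have e : fourierL2 (g + h) = fourierL2 g + fourierL2 h := map_add fourierCLM g h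
  rw [e]
  filter_upwards [Lp.coeFn_add (fourierL2 g) (fourierL2 h)] with ξ hξ
  simp only [hξ, Pi.add_apply, mul_add]

lemma sobolevNorm_smul (ℓ c : ℝ) (g : L2) : sobolevNorm ℓ (c • g) = ‖c‖ₑ * sobolevNorm ℓ g := by
  simp only [sobolevNorm_eq_eLpNorm]
  rw [← eLpNorm_const_smul]
  refine eLpNorm_congr_ae ?_
  have e : fourierL2 (c • g) = c • fourierL2 g := map_smul fourierCLM c g
  rw [e]
  filter_upwards [Lp.coeFn_smul c (fourierL2 g)] with ξ hξ
  simp only [hξ, Pi.smul_apply, Complex.real_smul]; ring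

lemma sobolevNorm_neg (ℓ : ℝ) (g : L2) : sobolevNorm ℓ (-g) = sobolevNorm ℓ g := by
  rw [← neg_one_smul ℝ g, sobolevNorm_smul]; simp

lemma sobolevNorm_sub_le (ℓ : ℝ) (g h : L2) :
    sobolevNorm ℓ (g - h) ≤ sobolevNorm ℓ g + sobolevNorm ℓ h := by
  rw [sub_eq_add_neg, ← sobolevNorm_neg ℓ h]; exact sobolevNorm_add_le ℓ g (-h)

lemma enorm_sq_eq (g : L2) : ‖g‖ₑ ^ 2 = ∫⁻ ξ, ‖fourierL2 g ξ‖ₑ ^ 2 := by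
  rw [← eLpNorm_two_sq, ← Lp.enorm_def, ← fourierCLM_apply, ← ofReal_norm,
    ← ofReal_norm, norm_fourierCLM]

lemma enorm_le_sobolevNorm {ℓ : ℝ} (hℓ : 0 ≤ ℓ) (g : L2) : ‖g‖ₑ ≤ sobolevNorm ℓ g := by
  refine le_of_sq_le_sq ?_
  rw [enorm_sq_eq, sobolevNorm_sq]
  refine lintegral_mono fun ξ => le_mul_of_one_le_left' ?_
  rw [ENNReal.one_le_ofReal]
  exact Real.one_le_rpow (one_le_japanese ξ) hℓ

/-! ### Fourier symbols of the resolvent and of the nonlinearity -/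

/-- The Fourier transform of a real Schwartz function. -/
noncomputable def schwartzHat (χ : 𝓢(ℝ, ℝ)) : 𝓢(ℝ, ℂ) := 𝓕 (χ.postcompCLM Complex.ofRealCLM)

lemma fourierL2_toLp (χ : 𝓢(ℝ, ℝ)) : fourierL2 (χ.toLp 2) = (schwartzHat χ).toLp 2 := by
  have h : Complex.ofRealCLM.compLp (χ.toLp 2 volume : L2) =
      (χ.postcompCLM Complex.ofRealCLM).toLp 2 := by
    refine Lp.ext ?_
    filter_upwards [χ.coeFn_toLp 2, (χ.postcompCLM Complex.ofRealCLM).coeFn_toLp 2,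
      Complex.ofRealCLM.coeFn_compLp (χ.toLp 2 volume : L2)] with x h1 h2 h3
    rw [h3, h1, h2]; rfl
  rw [fourierL2, h, SchwartzMap.toLp_fourier_eq, schwartzHat]

lemma fourierL2_toLp_ae (χ : 𝓢(ℝ, ℝ)) : fourierL2 (χ.toLp 2) =ᵐ[volume] schwartzHat χ := by
  rw [fourierL2_toLp]; exact (schwartzHat χ).coeFn_toLp 2

lemma schwartzHat_add (χ ψ : 𝓢(ℝ, ℝ)) : schwartzHat (χ + ψ) = schwartzHat χ + schwartzHat ψ := by
  rw [schwartzHat, map_add]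
  exact map_add (FourierTransform.fourierEquiv ℂ 𝓢(ℝ, ℂ)) _ _

lemma schwartzHat_sub (χ ψ : 𝓢(ℝ, ℝ)) : schwartzHat (χ - ψ) = schwartzHat χ - schwartzHat ψ := by
  rw [schwartzHat, map_sub]
  exact map_sub (FourierTransform.fourierEquiv ℂ 𝓢(ℝ, ℂ)) _ _

lemma schwartzHat_sderiv (χ : 𝓢(ℝ, ℝ)) (ξ : ℝ) :
    schwartzHat (sderiv χ) ξ = (2 * Real.pi * ξ * Complex.I) * schwartzHat χ ξ := by
  have h1 : (inner ℝ · (1 : ℝ) : ℝ → ℝ).HasTemperateGrowth := by fun_prop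
  have e : (sderiv χ).postcompCLM Complex.ofRealCLM =
      SchwartzMap.derivCLM ℝ ℂ (χ.postcompCLM Complex.ofRealCLM) := by
    ext x
    simp only [SchwartzMap.derivCLM_apply, SchwartzMap.postcompCLM_apply]
    exact ((Complex.ofRealCLM.hasFDerivAt.comp_hasDerivAt x (χ.hasDerivAt x))).deriv.symm
  rw [schwartzHat, e, ← lineDerivOp_one_eq_derivCLM, SchwartzMap.fourier_lineDerivOp_eq,
    _root_.smul_apply, SchwartzMap.smulLeftCLM_apply_apply h1, schwartzHat]
  simp only [RCLike.inner_apply, conj_trivial, one_mul, Complex.real_smul, smul_eq_mul]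
  ring

lemma schwartzHat_bessel (χ : 𝓢(ℝ, ℝ)) (ξ : ℝ) :
    schwartzHat (bessel χ) ξ = (japanese ξ : ℂ) * schwartzHat χ ξ := by
  rw [bessel, schwartzHat_sub, _root_.sub_apply, schwartzHat_sderiv, schwartzHat_sderiv, japanese]
  push_cast
  linear_combination (-(2 * Real.pi * ξ) ^ 2 * schwartzHat χ ξ) * Complex.I_sq

lemma norm_one_add_symbol_sq (ξ : ℝ) :
    ‖(1 + 2 * Real.pi * ξ * Complex.I : ℂ)‖ ^ 2 = japanese ξ := by
  have := Complex.sq_norm (1 + 2 * Real.pi * ξ * Complex.I : ℂ)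
  rw [this, Complex.normSq_apply, japanese]
  simp; ring

lemma one_add_symbol_ne_zero (ξ : ℝ) : (1 + 2 * Real.pi * ξ * Complex.I : ℂ) ≠ 0 := fun h => by
  have := norm_one_add_symbol_sq ξ
  rw [h] at this
  have h2 := japanese_pos ξ
  simp at this; linarith

/-- The symbol of `(1 + ∂)⁻¹`. -/
noncomputable def resolventSymbol : Lp ℂ ∞ (volume : Measure ℝ) :=
  MemLp.toLp (fun ξ : ℝ => (1 + 2 * Real.pi * ξ * Complex.I : ℂ)⁻¹) <| by
    refine memLp_top_of_bound (Measurable.aestronglyMeasurable (by fun_prop)) 1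
      (ae_of_all _ fun ξ => ?_)
    rw [norm_inv]
    refine inv_le_one_of_one_le₀ ?_
    have h1 := norm_one_add_symbol_sq ξ
    have h2 := one_le_japanese ξ
    by_contra! h
    nlinarith [norm_nonneg (1 + 2 * Real.pi * ξ * Complex.I : ℂ)]

lemma fourierL2_resolvent (z : L2) : fourierL2 (resolvent z) =ᵐ[volume]
    fun ξ => (1 + 2 * Real.pi * ξ * Complex.I : ℂ)⁻¹ * fourierL2 z ξ := by
  have hs : resolventSymbol =ᵐ[volume] fun ξ : ℝ => (1 + 2 * Real.pi * ξ * Complex.I : ℂ)⁻¹ :=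
    MemLp.coeFn_toLp _
  set T := (ContinuousLinearMap.mul ℝ ℂ).holderL volume ∞ 2 2 resolventSymbol
  have hT : ∀ g : Lp ℂ 2 (volume : Measure ℝ), T g =ᵐ[volume]
      fun ξ => (1 + 2 * Real.pi * ξ * Complex.I : ℂ)⁻¹ * g ξ := fun g => by
    filter_upwards [(ContinuousLinearMap.mul ℝ ℂ).coeFn_holder (r := 2) resolventSymbol g, hs]
      with ξ h1 h2
    refine h1.trans ?_
    rw [h2]; rfl
  have key : fourierCLM (resolvent z) = T (fourierCLM z) := by
    refine DenseRange.induction_on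
      (p := fun z => fourierCLM (resolvent z) = T (fourierCLM z)) denseRange_add_deriv z
      (isClosed_eq (by fun_prop) (by fun_prop)) fun χ => ?_
    rw [resolvent_add_deriv, fourierCLM_apply, fourierCLM_apply]
    refine Lp.ext ?_
    filter_upwards [fourierL2_toLp_ae χ, hT (fourierL2 ((χ + sderiv χ).toLp 2)),
      fourierL2_toLp_ae (χ + sderiv χ)] with ξ h1 h2 h3
    rw [h1, h2, h3, schwartzHat_add, _root_.add_apply, schwartzHat_sderiv]
    field_simp [one_add_symbol_ne_zero ξ]
  rw [← fourierCLM_apply, key, fourierCLM_apply]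
  exact hT _

/-- The operator `(1 + ∂)⁻¹` maps `L²` into `H¹`, hence into `H^ℓ` for `ℓ ≤ 1`. -/
lemma sobolevNorm_resolvent_le {ℓ : ℝ} (hℓ : ℓ ≤ 1) (z : L2) :
    sobolevNorm ℓ (resolvent z) ≤ ‖z‖ₑ := by
  refine le_of_sq_le_sq ?_
  rw [enorm_sq_eq, sobolevNorm_sq]
  refine lintegral_mono_ae ?_
  filter_upwards [fourierL2_resolvent z] with ξ hξ
  rw [hξ, enorm_mul, mul_pow, ← mul_assoc]
  refine mul_le_of_le_one_left' ?_
  have h1 : ‖(1 + 2 * Real.pi * ξ * Complex.I : ℂ)⁻¹‖ₑ ^ 2 = ENNReal.ofReal (japanese ξ)⁻¹ := by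
    rw [← ofReal_norm, ← ENNReal.ofReal_pow (norm_nonneg _), norm_inv, inv_pow,
      norm_one_add_symbol_sq]
  rw [h1, ← ENNReal.ofReal_mul (Real.rpow_nonneg (japanese_pos ξ).le _), ENNReal.ofReal_le_one]
  have := Real.rpow_le_rpow_of_exponent_le (one_le_japanese ξ) hℓ
  rw [Real.rpow_one] at this
  exact (mul_le_mul_of_nonneg_right this (inv_nonneg.2 (japanese_pos ξ).le)).trans
    (mul_inv_cancel₀ (japanese_pos ξ).ne').le

/-- The square of a real Schwartz function. -/
noncomputable def schwartzSq (χ : 𝓢(ℝ, ℝ)) : 𝓢(ℝ, ℝ) :=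
  SchwartzMap.pairing (ContinuousLinearMap.mul ℝ ℝ) χ χ

lemma schwartzSq_apply (χ : 𝓢(ℝ, ℝ)) (x : ℝ) : schwartzSq χ x = χ x * χ x := rfl

lemma schwartzHat_schwartzSq (χ : 𝓢(ℝ, ℝ)) (ξ : ℝ) :
    schwartzHat (schwartzSq χ) ξ = ∫ η, schwartzHat χ η * schwartzHat χ (ξ - η) := by
  set c : 𝓢(ℝ, ℂ) := χ.postcompCLM Complex.ofRealCLM
  set F : 𝓢(ℝ, ℂ) := schwartzHat χ
  have hF : ∀ x, 𝓕 F (-x) = c x := fun x => by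
    have h1 : 𝓕⁻ F = c := FourierTransform.fourierInv_fourier_eq c
    have h2 : 𝓕⁻ F x = 𝓕 F (-x) := by
      rw [SchwartzMap.fourierInv_coe, SchwartzMap.fourier_coe]
      exact Real.fourierInv_eq_fourier_neg _ _
    rw [← h2, h1]
  have h1 := SchwartzMap.convolution_apply (ContinuousLinearMap.mul ℂ ℂ) F F ξ
  have h2 : SchwartzMap.convolution (ContinuousLinearMap.mul ℂ ℂ) F F =
      𝓕⁻ (SchwartzMap.pairing (ContinuousLinearMap.mul ℂ ℂ) (𝓕 F) (𝓕 F)) := rfl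
  have h3 : (fun x => SchwartzMap.pairing (ContinuousLinearMap.mul ℂ ℂ) (𝓕 F) (𝓕 F) (-x)) =
      ⇑((schwartzSq χ).postcompCLM Complex.ofRealCLM) := by
    ext x
    change 𝓕 F (-x) * 𝓕 F (-x) = Complex.ofRealCLM (schwartzSq χ x)
    rw [hF, schwartzSq_apply]
    simp [c]
  rw [h2, SchwartzMap.fourierInv_coe, Real.fourierInv_eq_fourier_comp_neg, h3] at h1
  rw [schwartzHat, SchwartzMap.fourier_coe, h1]
  rfl

lemma fourierL2_bilin_toLp (χ : 𝓢(ℝ, ℝ)) :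
    fourierL2 (bilin (χ.toLp 2) (χ.toLp 2)) =ᵐ[volume] fun ξ =>
      (2 * Real.pi * ξ * Complex.I / japanese ξ : ℂ) *
        ∫ η, schwartzHat χ η * schwartzHat χ (ξ - η) := by
  obtain ⟨ψ, hψ⟩ := exists_bessel_eq (schwartzSq χ)
  have h : bilin (χ.toLp 2) (χ.toLp 2) = (sderiv ψ).toLp 2 := by
    rw [bilin_apply]
    refine Lp.ext ((coeFn_convCLM 2 unitKernel_fluxKernel _).trans ?_)
    have e : (ContinuousLinearMap.mul ℝ ℝ).holder 1 (χ.toLp 2 volume : L2) (χ.toLp 2 volume : L2)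
        =ᵐ[volume] ⇑(bessel ψ) := by
      filter_upwards [(ContinuousLinearMap.mul ℝ ℝ).coeFn_holder (r := 1)
        (χ.toLp 2 volume : L2) (χ.toLp 2 volume : L2), χ.coeFn_toLp 2] with x h1 h2
      rw [h1, h2, hψ, schwartzSq_apply]; rfl
    rw [conv_congr_ae e, conv_fluxKernel_bessel]
    exact ((sderiv ψ).coeFn_toLp 2).symm
  rw [h]
  filter_upwards [fourierL2_toLp_ae (sderiv ψ)] with ξ hξ
  have hne : (japanese ξ : ℂ) ≠ 0 := by exact_mod_cast (japanese_pos ξ).ne'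
  rw [hξ, ← schwartzHat_schwartzSq, ← hψ, schwartzHat_bessel, schwartzHat_sderiv]
  field_simp

/-- The reflection `g ↦ g(ξ - ·)` on `L²`. -/
noncomputable def reflect (ξ : ℝ) :
    Lp ℂ 2 (volume : Measure ℝ) →ₗᵢ[ℂ] Lp ℂ 2 (volume : Measure ℝ) :=
  Lp.compMeasurePreservingₗᵢ ℂ (fun η => ξ - η) (Measure.measurePreserving_sub_left volume ξ)

lemma coeFn_reflect (ξ : ℝ) (g : Lp ℂ 2 (volume : Measure ℝ)) :
    reflect ξ g =ᵐ[volume] fun η => g (ξ - η) :=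
  Lp.coeFn_compMeasurePreserving g (Measure.measurePreserving_sub_left volume ξ)

/-- The convolution `∫ g(η) g(ξ - η) dη` depends continuously on `g ∈ L²`. -/
lemma continuous_selfConv (ξ : ℝ) :
    Continuous fun g : Lp ℂ 2 (volume : Measure ℝ) => ∫ η, g η * g (ξ - η) := by
  have h : ∀ g : Lp ℂ 2 (volume : Measure ℝ), ∫ η, g η * g (ξ - η) =
      (ContinuousLinearMap.mul ℂ ℂ).lpPairing volume 2 2 g (reflect ξ g) := fun g => by
    rw [ContinuousLinearMap.lpPairing_eq_integral]
    refine integral_congr_ae ?_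
    filter_upwards [coeFn_reflect ξ g] with η hη
    rw [hη]; rfl
  simp only [h]
  have := (reflect ξ).continuous
  fun_prop

/-- The Fourier transform of `∂ (1 - ∂²)⁻¹ (w²)` as a convolution. It is obtained from the case of
Schwartz functions along an almost everywhere convergent subsequence. -/
lemma fourierL2_bilin (w : L2) :
    fourierL2 (bilin w w) =ᵐ[volume] fun ξ =>
      (2 * Real.pi * ξ * Complex.I / japanese ξ : ℂ) *
        ∫ η, fourierL2 w η * fourierL2 w (ξ - η) := by
  obtain ⟨v, hv, hlim⟩ := mem_closure_iff_seq_limit.1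
    ((SchwartzMap.denseRange_toLpCLM (E := ℝ) (F := ℝ) (μ := volume) (p := 2)
      ENNReal.ofNat_ne_top) w)
  choose χ hχ using hv
  have h1 : Tendsto (fun n => fourierCLM (bilin (v n) (v n))) atTop
      (𝓝 (fourierCLM (bilin w w))) := by
    have hc : Continuous fun w : L2 => fourierCLM (bilin w w) := by fun_prop
    exact (hc.tendsto w).comp hlim
  obtain ⟨ns, hns, hae⟩ := (tendstoInMeasure_of_tendsto_Lp h1).exists_seq_tendsto_ae
  have h2 : ∀ᵐ ξ, ∀ n, fourierL2 (bilin (v n) (v n)) ξ =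
      (2 * Real.pi * ξ * Complex.I / japanese ξ : ℂ) *
        ∫ η, fourierL2 (v n) η * fourierL2 (v n) (ξ - η) := by
    rw [ae_all_iff]
    intro n
    have e : v n = (χ n).toLp 2 := (hχ n).symm
    rw [e]
    filter_upwards [fourierL2_bilin_toLp (χ n)] with ξ hξ
    rw [hξ]
    congr 1
    refine integral_congr_ae ?_
    have e2 := fourierL2_toLp_ae (χ n)
    filter_upwards [e2, (Measure.measurePreserving_sub_left volume ξ).quasiMeasurePreserving.ae e2]
      with η h3 h4
    rw [h3, h4]
  filter_upwards [hae, h2] with ξ h3 h4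
  refine tendsto_nhds_unique h3 ?_
  simp only [fourierCLM_apply, h4]
  refine Tendsto.const_mul _ ?_
  have hc := (continuous_selfConv ξ).comp fourierCLM.continuous
  exact ((hc.tendsto w).comp hlim).comp hns.tendsto_atTop

/-! ### The tame estimate -/

/-- Peetre-type inequality `⟨ξ⟩^ℓ ≤ 2 (⟨η⟩^ℓ + ⟨ξ - η⟩^ℓ)` for `0 ≤ ℓ ≤ 1`, where
`⟨ξ⟩² = 1 + (2πξ)²`. -/
lemma japanese_rpow_le {ℓ : ℝ} (h0 : 0 ≤ ℓ) (h1 : ℓ ≤ 1) (ξ η : ℝ) :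
    japanese ξ ^ (ℓ / 2) ≤ 2 * (japanese η ^ (ℓ / 2) + japanese (ξ - η) ^ (ℓ / 2)) := by
  have key : ∀ a b : ℝ, japanese b ≤ japanese a → japanese (a + b) ≤ 4 * japanese a := by
    intro a b hab
    simp only [japanese] at hab ⊢
    nlinarith [sq_nonneg (2 * Real.pi * a - 2 * Real.pi * b)]
  have key2 : ∀ a b : ℝ, japanese b ≤ japanese a →
      japanese (a + b) ^ (ℓ / 2) ≤ 2 * japanese a ^ (ℓ / 2) := by
    intro a b hab
    calc _ ≤ (4 * japanese a) ^ (ℓ / 2) :=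
          Real.rpow_le_rpow (japanese_pos _).le (key a b hab) (by linarith)
      _ = 4 ^ (ℓ / 2) * japanese a ^ (ℓ / 2) :=
          Real.mul_rpow (by norm_num) (japanese_pos _).le
      _ ≤ 4 ^ ((1 : ℝ) / 2) * japanese a ^ (ℓ / 2) := by
          refine mul_le_mul_of_nonneg_right ?_ (Real.rpow_nonneg (japanese_pos _).le _)
          exact Real.rpow_le_rpow_of_exponent_le (by norm_num) (by linarith)
      _ = _ := by
          congr 1
          rw [show (4 : ℝ) = 2 ^ (2 : ℝ) by norm_num, ← Real.rpow_mul (by norm_num)]; norm_num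
  have p1 := Real.rpow_nonneg (japanese_pos η).le (ℓ / 2)
  have p2 := Real.rpow_nonneg (japanese_pos (ξ - η)).le (ℓ / 2)
  rcases le_total (japanese η) (japanese (ξ - η)) with h | h
  · have := key2 _ _ h
    rw [sub_add_cancel] at this; linarith
  · have := key2 _ _ h
    rw [add_sub_cancel] at this; linarith

lemma lintegral_inv_japanese_le : ∫⁻ ξ, ENNReal.ofReal (japanese ξ)⁻¹ ≤ 4 := by
  calc _ ≤ ∫⁻ ξ : ℝ, ENNReal.ofReal (1 + ξ ^ 2)⁻¹ := by
        refine lintegral_mono fun ξ => ENNReal.ofReal_le_ofReal (inv_anti₀ (by positivity) ?_)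
        have hπ : 1 ≤ (2 * Real.pi) ^ 2 := by nlinarith [Real.pi_gt_three]
        rw [japanese, mul_pow]
        nlinarith [sq_nonneg ξ]
    _ = ENNReal.ofReal Real.pi := by
        rw [← integral_univ_inv_one_add_sq, ofReal_integral_eq_lintegral_ofReal]
        · exact integrable_inv_one_add_sq
        · exact ae_of_all _ fun ξ => by positivity
    _ ≤ 4 := by
        rw [← ENNReal.ofReal_ofNat]
        exact ENNReal.ofReal_le_ofReal Real.pi_lt_four.le

lemma lintegral_mul_reflect_le {g h : ℝ → ℂ} (hg : AEStronglyMeasurable g)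
    (hh : AEStronglyMeasurable h) (ξ : ℝ) :
    ∫⁻ η, ‖g η‖ₑ * ‖h (ξ - η)‖ₑ ≤ eLpNorm g 2 volume * eLpNorm h 2 volume := by
  have hmp := Measure.measurePreserving_sub_left (volume : Measure ℝ) ξ
  have hh' : AEStronglyMeasurable fun η => h (ξ - η) := hh.comp_measurePreserving hmp
  have h1 := ENNReal.lintegral_mul_le_Lp_mul_Lq volume Real.HolderConjugate.two_two hg.enorm
    hh'.enorm
  have h2 : eLpNorm (fun η => h (ξ - η)) 2 volume = eLpNorm h 2 volume :=
    eLpNorm_comp_measurePreserving hh hmp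
  rw [← h2, eLpNorm_eq_lintegral_rpow_enorm_toReal (by norm_num) (by norm_num),
    eLpNorm_eq_lintegral_rpow_enorm_toReal (by norm_num) (by norm_num)]
  simpa using h1

/-- The nonlinearity maps `H^ℓ` to itself, with a bound that is linear in the `H^ℓ` norm: it
gains one derivative, and the weight `1 / ⟨ξ⟩` is square integrable. -/
lemma sobolevNorm_bilin_self_le {ℓ : ℝ} (h0 : 0 ≤ ℓ) (h1 : ℓ ≤ 1) (w : L2) :
    sobolevNorm ℓ (bilin w w) ≤ 8 * (sobolevNorm ℓ w * ‖w‖ₑ) := by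
  set W := fourierL2 w
  set N := sobolevNorm ℓ w * ‖w‖ₑ
  have hWn : eLpNorm W 2 volume = ‖w‖ₑ := by
    rw [← Lp.enorm_def, ← ofReal_norm, ← ofReal_norm, ← norm_fourierCLM w]; rfl
  have hint : ∀ ξ, ENNReal.ofReal (japanese ξ ^ (ℓ / 2)) * ‖∫ η, W η * W (ξ - η)‖ₑ ≤ 4 * N := by
    intro ξ
    set a : ℝ → ℂ := fun η => ((japanese η ^ (ℓ / 2) : ℝ) : ℂ) * W η
    have ha : AEStronglyMeasurable a := aestronglyMeasurable_weight_mul ℓ w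
    have hb : AEStronglyMeasurable (W : ℝ → ℂ) := Lp.aestronglyMeasurable W
    have b1 := lintegral_mul_reflect_le ha hb ξ
    have b2 := lintegral_mul_reflect_le hb ha ξ
    rw [← sobolevNorm_eq_eLpNorm, hWn] at b1 b2
    calc _ ≤ ENNReal.ofReal (japanese ξ ^ (ℓ / 2)) * ∫⁻ η, ‖W η‖ₑ * ‖W (ξ - η)‖ₑ := by
          refine mul_le_mul_right ((enorm_integral_le_lintegral_enorm _).trans (le_of_eq ?_)) _
          simp only [enorm_mul]
      _ = ∫⁻ η, ENNReal.ofReal (japanese ξ ^ (ℓ / 2)) * (‖W η‖ₑ * ‖W (ξ - η)‖ₑ) :=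
          (lintegral_const_mul' _ _ ENNReal.ofReal_ne_top).symm
      _ ≤ ∫⁻ η, 2 * (‖a η‖ₑ * ‖W (ξ - η)‖ₑ + ‖W η‖ₑ * ‖a (ξ - η)‖ₑ) := by
          refine lintegral_mono fun η => ?_
          simp only [a, enorm_weight_mul]
          calc _ ≤ ENNReal.ofReal (2 * (japanese η ^ (ℓ / 2) + japanese (ξ - η) ^ (ℓ / 2))) *
                (‖W η‖ₑ * ‖W (ξ - η)‖ₑ) :=
                mul_le_mul_left (ENNReal.ofReal_le_ofReal (japanese_rpow_le h0 h1 ξ η)) _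
            _ = _ := by
                rw [ENNReal.ofReal_mul zero_le_two, ENNReal.ofReal_add
                  (Real.rpow_nonneg (japanese_pos _).le _)
                  (Real.rpow_nonneg (japanese_pos _).le _), ENNReal.ofReal_ofNat]
                ring
      _ = 2 * ((∫⁻ η, ‖a η‖ₑ * ‖W (ξ - η)‖ₑ) + ∫⁻ η, ‖W η‖ₑ * ‖a (ξ - η)‖ₑ) := by
          rw [lintegral_const_mul' _ _ (by simp), lintegral_add_left']
          exact ha.enorm.mul ((hb.comp_measurePreserving
            (Measure.measurePreserving_sub_left (volume : Measure ℝ) ξ)).enorm)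
      _ ≤ 2 * (N + ‖w‖ₑ * sobolevNorm ℓ w) := by gcongr
      _ = 4 * N := by simp only [N]; ring
  refine le_of_sq_le_sq ?_
  rw [sobolevNorm_sq]
  calc _ ≤ ∫⁻ ξ, ENNReal.ofReal (japanese ξ)⁻¹ * (4 * N) ^ 2 := by
        refine lintegral_mono_ae ?_
        filter_upwards [fourierL2_bilin w] with ξ hξ
        rw [hξ, enorm_mul, mul_pow, ofReal_japanese_rpow, mul_left_comm, ← mul_pow]
        refine mul_le_mul' ?_ (pow_le_pow_left' (hint ξ) 2)
        rw [← ofReal_norm, ← ENNReal.ofReal_pow (norm_nonneg _)]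
        refine ENNReal.ofReal_le_ofReal ?_
        have hn : ‖(2 * Real.pi * ξ * Complex.I / japanese ξ : ℂ)‖ =
            |2 * Real.pi * ξ| / japanese ξ := by
          have e : (2 * Real.pi * ξ * Complex.I / japanese ξ : ℂ) =
              ((2 * Real.pi * ξ : ℝ) : ℂ) * Complex.I / (japanese ξ : ℝ) := by push_cast; rfl
          rw [e, norm_div, norm_mul, Complex.norm_I, mul_one, Complex.norm_real, Complex.norm_real,
            Real.norm_eq_abs, Real.norm_of_nonneg (japanese_pos ξ).le]
        rw [hn, div_pow, sq_abs, div_le_iff₀ (pow_pos (japanese_pos ξ) 2), sq (japanese ξ),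
          inv_mul_cancel_left₀ (japanese_pos ξ).ne', japanese]
        linarith
    _ = (∫⁻ ξ, ENNReal.ofReal (japanese ξ)⁻¹) * (4 * N) ^ 2 := by
        refine lintegral_mul_const _ ?_
        exact (measurable_japanese.inv).ennreal_ofReal
    _ ≤ 4 * (4 * N) ^ 2 := mul_le_mul_left lintegral_inv_japanese_le _
    _ = (8 * N) ^ 2 := by ring

/-! ### A dissipative quadratic equation in a Hilbert space -/

section ODE

variable {H : Type*} [NormedAddCommGroup H] [InnerProductSpace ℝ H]

/-- The radial retraction of `H` onto the closed ball of radius `ρ`. -/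
noncomputable def retract (ρ : ℝ) (x : H) : H := (ρ / max ρ ‖x‖) • x

lemma retract_of_norm_le {ρ : ℝ} (hρ : 0 < ρ) {x : H} (hx : ‖x‖ ≤ ρ) : retract ρ x = x := by
  rw [retract, max_eq_left hx, div_self hρ.ne', one_smul]

lemma norm_retract_le {ρ : ℝ} (hρ : 0 < ρ) (x : H) : ‖retract ρ x‖ ≤ ρ := by
  have hm : 0 < max ρ ‖x‖ := lt_max_of_lt_left hρ
  rw [retract, norm_smul, Real.norm_of_nonneg (by positivity), div_mul_eq_mul_div,
    div_le_iff₀ hm]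
  exact mul_le_mul_of_nonneg_left (le_max_right _ _) hρ.le

lemma norm_retract_sub_le {ρ : ℝ} (hρ : 0 < ρ) (x y : H) :
    ‖retract ρ x - retract ρ y‖ ≤ 2 * ‖x - y‖ := by
  set a := max ρ ‖x‖
  set b := max ρ ‖y‖
  have ha : ρ ≤ a := le_max_left _ _
  have hb : ρ ≤ b := le_max_left _ _
  have hyb : ‖y‖ ≤ b := le_max_right _ _
  have ha0 : 0 < a := hρ.trans_le ha
  have hb0 : 0 < b := hρ.trans_le hb
  have hab : |b - a| ≤ ‖x - y‖ := by
    have h1 : |b - a| ≤ |‖y‖ - ‖x‖| := by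
      have := abs_max_sub_max_le_max ρ ‖y‖ ρ ‖x‖
      simpa using this
    refine h1.trans ((abs_norm_sub_norm_le y x).trans (le_of_eq (norm_sub_rev _ _)))
  have e : retract ρ x - retract ρ y = (ρ / a) • (x - y) + (ρ / a - ρ / b) • y := by
    simp only [retract, a, b]; module
  have e2 : ρ / a - ρ / b = ρ / a * ((b - a) / b) := by field_simp
  have h1 : ρ / a ≤ 1 := (div_le_one ha0).2 ha
  have h0 : 0 ≤ ρ / a := (div_pos hρ ha0).le
  rw [e, two_mul]
  refine (norm_add_le _ _).trans (add_le_add ?_ ?_)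
  · rw [norm_smul, Real.norm_of_nonneg h0]
    exact mul_le_of_le_one_left (norm_nonneg _) h1
  · rw [norm_smul, e2, Real.norm_eq_abs, abs_mul, abs_of_nonneg h0, abs_div, abs_of_pos hb0]
    calc _ ≤ 1 * (|b - a| / b) * b := by gcongr
      _ = |b - a| := by field_simp
      _ ≤ _ := hab

/-- The vector field `-x + Q(x, x) + L(t) x + F(t)`. -/
noncomputable def quadField (Q : H →L[ℝ] H →L[ℝ] H) (L : ℝ → H →L[ℝ] H) (F : ℝ → H) (t : ℝ)
    (x : H) : H :=
  -x + Q x x + L t x + F t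

variable {Q : H →L[ℝ] H →L[ℝ] H} {L : ℝ → H →L[ℝ] H} {F : ℝ → H} {c D : ℝ}

lemma norm_quad_sub_le {ρ : ℝ} {x y : H} (hx : ‖x‖ ≤ ρ) (hy : ‖y‖ ≤ ρ) :
    ‖Q x x - Q y y‖ ≤ 2 * ρ * ‖Q‖ * ‖x - y‖ := by
  have e : Q x x - Q y y = Q x (x - y) + Q (x - y) y := by
    simp only [map_sub, _root_.sub_apply]; abel
  rw [e]
  have h1 := (Q.le_opNorm₂ x (x - y))
  have h2 := (Q.le_opNorm₂ (x - y) y)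
  have h3 : ‖Q‖ * ‖x‖ * ‖x - y‖ ≤ ‖Q‖ * ρ * ‖x - y‖ := by gcongr
  have h4 : ‖Q‖ * ‖x - y‖ * ‖y‖ ≤ ‖Q‖ * ‖x - y‖ * ρ := by gcongr
  calc _ ≤ _ := norm_add_le _ _
    _ ≤ ‖Q‖ * ρ * ‖x - y‖ + ‖Q‖ * ‖x - y‖ * ρ := add_le_add (h1.trans h3) (h2.trans h4)
    _ = _ := by ring

/-- If `E` satisfies `E' ≤ (2c + 1) e^{-t} (E + D²)` then it stays bounded. -/
lemma bound_of_deriv_le {E E' : ℝ → ℝ} {T : ℝ} (hE : ContinuousOn E (Set.Icc 0 T))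
    (hE' : ∀ t ∈ Set.Ioo 0 T, HasDerivAt E (E' t) t) (h0 : E 0 = 0) (hc : 0 ≤ c)
    (hE0 : ∀ t, 0 ≤ E t)
    (hle : ∀ t ∈ Set.Ioo 0 T, E' t ≤ (2 * c + 1) * Real.exp (-t) * (E t + D ^ 2))
    {t : ℝ} (ht : t ∈ Set.Icc 0 T) : E t ≤ D ^ 2 * Real.exp (2 * c + 1) := by
  set g : ℝ → ℝ := fun t => Real.exp ((2 * c + 1) * Real.exp (-t))
  have hg : ∀ t, HasDerivAt g (g t * ((2 * c + 1) * -Real.exp (-t))) t := fun t => by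
    have h1 : HasDerivAt (fun t => Real.exp (-t)) (-Real.exp (-t)) t := by
      simpa using (hasDerivAt_neg t).exp
    exact (h1.const_mul (2 * c + 1)).exp
  have hanti : AntitoneOn (fun t => (E t + D ^ 2) * g t) (Set.Icc 0 T) := by
    refine antitoneOn_of_hasDerivWithinAt_nonpos (convex_Icc 0 T)
      (f' := fun t => E' t * g t + (E t + D ^ 2) * (g t * ((2 * c + 1) * -Real.exp (-t))))
      ((hE.add continuousOn_const).mul fun t _ => (hg t).continuousAt.continuousWithinAt) ?_ ?_
    · intro t ht
      rw [interior_Icc] at ht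
      exact (((hE' t ht).add_const _).mul (hg t)).hasDerivWithinAt
    · intro t ht
      rw [interior_Icc] at ht
      have h1 := hle t ht
      have h2 : 0 < g t := Real.exp_pos _
      nlinarith
  have h := hanti ⟨le_rfl, ht.1.trans ht.2⟩ ht ht.1
  simp only [h0, zero_add, g, neg_zero, Real.exp_zero, mul_one] at h
  have h1 : 1 ≤ Real.exp ((2 * c + 1) * Real.exp (-t)) := Real.one_le_exp (by positivity)
  nlinarith [hE0 t, sq_nonneg D]

/-- If `E` satisfies `E' ≤ (-1 + 2c e^{-t}) E + 2 D² e^{-2t}` then it decays like `e^{-t}`. -/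
lemma decay_of_deriv_le {E E' : ℝ → ℝ} {T : ℝ} (hE : ContinuousOn E (Set.Icc 0 T))
    (hE' : ∀ t ∈ Set.Ioo 0 T, HasDerivAt E (E' t) t) (h0 : E 0 = 0) (hc : 0 ≤ c)
    (hE0 : ∀ t, 0 ≤ E t)
    (hle : ∀ t ∈ Set.Ioo 0 T, E' t ≤ (-1 + 2 * c * Real.exp (-t)) * E t +
      2 * D ^ 2 * Real.exp (-t) ^ 2)
    {t : ℝ} (ht : t ∈ Set.Icc 0 T) : E t ≤ 2 * D ^ 2 * Real.exp (2 * c) * Real.exp (-t) := by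
  set g : ℝ → ℝ := fun t => Real.exp (t + 2 * c * Real.exp (-t))
  have he : ∀ t, HasDerivAt (fun t => Real.exp (-t)) (-Real.exp (-t)) t := fun t => by
      simpa using (hasDerivAt_neg t).exp
  have hg : ∀ t, HasDerivAt g (g t * (1 + 2 * c * -Real.exp (-t))) t := fun t =>
    ((hasDerivAt_id t).add ((he t).const_mul (2 * c))).exp
  set B := 2 * D ^ 2 * Real.exp (2 * c)
  have hanti : AntitoneOn (fun t => E t * g t + B * Real.exp (-t)) (Set.Icc 0 T) := by
    refine antitoneOn_of_hasDerivWithinAt_nonpos (convex_Icc 0 T)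
      (f' := fun t => E' t * g t + E t * (g t * (1 + 2 * c * -Real.exp (-t))) +
        B * -Real.exp (-t))
      ((hE.mul fun t _ => (hg t).continuousAt.continuousWithinAt).add
        (by fun_prop)) ?_ ?_
    · intro t ht
      rw [interior_Icc] at ht
      exact (((hE' t ht).mul (hg t)).add ((he t).const_mul B)).hasDerivWithinAt
    · intro t ht
      rw [interior_Icc] at ht
      have h1 := mul_le_mul_of_nonneg_right (hle t ht) (Real.exp_pos _ : 0 < g t).le
      have h2 : g t * Real.exp (-t) ≤ Real.exp (2 * c) := by
        simp only [g]
        rw [← Real.exp_add, Real.exp_le_exp]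
        have : Real.exp (-t) ≤ 1 := Real.exp_le_one_iff.2 (by linarith [ht.1])
        nlinarith
      have h3 : 2 * D ^ 2 * Real.exp (-t) ^ 2 * g t ≤ B * Real.exp (-t) := by
        have := mul_le_mul_of_nonneg_left h2
          (by positivity : 0 ≤ 2 * D ^ 2 * Real.exp (-t))
        simp only [B]
        nlinarith
      nlinarith
  have h := hanti ⟨le_rfl, ht.1.trans ht.2⟩ ht ht.1
  simp only [h0, zero_mul, zero_add, neg_zero, Real.exp_zero, mul_one] at h
  have hB : 0 ≤ B := by positivity
  have h1 : Real.exp t ≤ g t := by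
    simp only [g]
    rw [Real.exp_le_exp]
    have := Real.exp_pos (-t)
    nlinarith
  have h2 : E t * Real.exp t ≤ B := by
    have := mul_le_mul_of_nonneg_left h1 (hE0 t)
    have := mul_nonneg hB (Real.exp_pos (-t)).le
    linarith
  rw [Real.exp_neg, ← div_eq_mul_inv, le_div_iff₀ (Real.exp_pos t)]
  exact h2

/-- The energy estimate. -/
lemma inner_quadField_le (hQ : ∀ x, inner ℝ x (Q x x) = 0) {t : ℝ}
    (hL : ‖L t‖ ≤ 1 / 4 + c * Real.exp (-t)) (hF : ‖F t‖ ≤ D * Real.exp (-t)) (x : H) :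
    2 * inner ℝ x (quadField Q L F t x) ≤
      (-1 + 2 * c * Real.exp (-t)) * ‖x‖ ^ 2 + 2 * D ^ 2 * Real.exp (-t) ^ 2 := by
  rw [quadField, inner_add_right, inner_add_right, inner_add_right, hQ, inner_neg_right,
    real_inner_self_eq_norm_sq]
  have h1 : inner ℝ x (L t x) ≤ (1 / 4 + c * Real.exp (-t)) * ‖x‖ ^ 2 := by
    calc _ ≤ ‖x‖ * ‖L t x‖ := real_inner_le_norm _ _
      _ ≤ ‖x‖ * ((1 / 4 + c * Real.exp (-t)) * ‖x‖) := by
          gcongr; exact (L t).le_of_opNorm_le hL x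
      _ = _ := by ring
  have h2 : inner ℝ x (F t) ≤ ‖x‖ * (D * Real.exp (-t)) :=
    (real_inner_le_norm _ _).trans (by gcongr)
  nlinarith [sq_nonneg (‖x‖ / 2 - 2 * (D * Real.exp (-t)) / 2)]

/-- An energy estimate for the truncated equation that does not depend on the truncation. -/
lemma inner_quadField_retract_le (hQ : ∀ x, inner ℝ x (Q x x) = 0) {t ρ : ℝ} (hρ : 0 < ρ)
    (hc : 0 ≤ c)
    (hL : ‖L t‖ ≤ 1 / 4 + c * Real.exp (-t)) (hF : ‖F t‖ ≤ D * Real.exp (-t)) (x : H) :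
    2 * inner ℝ x (quadField Q L F t (retract ρ x)) ≤
      (2 * c + 1) * Real.exp (-t) * (‖x‖ ^ 2 + D ^ 2) := by
  have hm : 0 < max ρ ‖x‖ := lt_max_of_lt_left hρ
  set s := ρ / max ρ ‖x‖ with hs
  have hs0 : 0 ≤ s := (div_pos hρ hm).le
  have hs1 : s ≤ 1 := (div_le_one hm).2 (le_max_left _ _)
  have he := Real.exp_pos (-t)
  have e : retract ρ x = s • x := rfl
  rw [quadField, e, inner_add_right, inner_add_right, inner_add_right, inner_neg_right]
  simp only [map_smul, _root_.smul_apply, real_inner_smul_right, hQ, mul_zero, add_zero,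
    real_inner_self_eq_norm_sq]
  have h1 : inner ℝ x (L t x) ≤ (1 / 4 + c * Real.exp (-t)) * ‖x‖ ^ 2 := by
    calc _ ≤ ‖x‖ * ‖L t x‖ := real_inner_le_norm _ _
      _ ≤ ‖x‖ * ((1 / 4 + c * Real.exp (-t)) * ‖x‖) := by
          gcongr; exact (L t).le_of_opNorm_le hL x
      _ = _ := by ring
  have h2 : inner ℝ x (F t) ≤ ‖x‖ * (D * Real.exp (-t)) :=
    (real_inner_le_norm _ _).trans (by gcongr)
  have h3 : -(s * ‖x‖ ^ 2) + s * inner ℝ x (L t x) ≤ c * Real.exp (-t) * ‖x‖ ^ 2 := by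
    have := mul_le_mul_of_nonneg_left h1 hs0
    have h5 : s * (c * Real.exp (-t) * ‖x‖ ^ 2) ≤ 1 * (c * Real.exp (-t) * ‖x‖ ^ 2) := by gcongr
    nlinarith [mul_nonneg hs0 (sq_nonneg ‖x‖)]
  have h4 : 2 * (‖x‖ * (D * Real.exp (-t))) ≤ Real.exp (-t) * (‖x‖ ^ 2 + D ^ 2) := by
    nlinarith [mul_nonneg he.le (sq_nonneg (‖x‖ - D))]
  have h6 : 0 ≤ c * Real.exp (-t) * D ^ 2 := by positivity
  nlinarith

variable [CompleteSpace H]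

/-- Global existence and decay for `z' = -z + Q(z, z) + L(t) z + F(t)`, `z(0) = 0`, when `Q`
conserves the norm, `L` is small for large times and `F` decays. -/
theorem exists_decaying_solution (hQ : ∀ x, inner ℝ x (Q x x) = 0) (hLc : Continuous L)
    (hFc : Continuous F) (hc : 0 ≤ c) (hD : 0 ≤ D)
    (hL : ∀ t, 0 ≤ t → ‖L t‖ ≤ 1 / 4 + c * Real.exp (-t))
    (hF : ∀ t, 0 ≤ t → ‖F t‖ ≤ D * Real.exp (-t)) :
    ∃ z : ℝ → H, z 0 = 0 ∧ ContinuousOn z (Set.Ici 0) ∧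
      (∀ t, 0 < t → HasDerivAt z (quadField Q L F t (z t)) t) ∧
      ∀ t, 0 ≤ t → ‖z t‖ ^ 2 ≤ 2 * D ^ 2 * Real.exp (2 * c) * Real.exp (-t) := by
  set ρ : ℝ := D * Real.exp (2 * c + 1) + 1
  have hρ : 0 < ρ := by positivity
  set V : ℝ → H → H := fun t x => quadField Q L F t (retract ρ x)
  have hexp : ∀ t : ℝ, 0 ≤ t → Real.exp (-t) ≤ 1 := fun t ht => Real.exp_le_one_iff.2 (by linarith)
  have hL' : ∀ t : ℝ, 0 ≤ t → ‖L t‖ ≤ 1 / 4 + c := fun t ht =>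
    (hL t ht).trans (by have := mul_le_mul_of_nonneg_left (hexp t ht) hc; linarith)
  set K : NNReal := ⟨2 * (1 + 2 * ρ * ‖Q‖ + (1 / 4 + c)), by positivity⟩
  have hLip : ∀ t, 0 ≤ t → LipschitzWith K (V t) := fun t ht =>
    LipschitzWith.of_dist_le_mul fun x y => by
      rw [dist_eq_norm, dist_eq_norm]
      have e : V t x - V t y = -(retract ρ x - retract ρ y) +
          (Q (retract ρ x) (retract ρ x) - Q (retract ρ y) (retract ρ y)) +
          L t (retract ρ x - retract ρ y) := by
        simp only [V, quadField, map_sub]; abel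
      have h1 := norm_retract_sub_le hρ x y
      have h2 := norm_quad_sub_le (Q := Q) (norm_retract_le hρ x) (norm_retract_le hρ y)
      have h3 : ‖L t (retract ρ x - retract ρ y)‖ ≤ (1 / 4 + c) * ‖retract ρ x - retract ρ y‖ :=
        (L t).le_of_opNorm_le (hL' t ht) _
      calc ‖V t x - V t y‖ ≤ ‖retract ρ x - retract ρ y‖ +
            2 * ρ * ‖Q‖ * ‖retract ρ x - retract ρ y‖ +
            (1 / 4 + c) * ‖retract ρ x - retract ρ y‖ := by
            rw [e]
            refine (norm_add_le _ _).trans (add_le_add ((norm_add_le _ _).trans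
              (add_le_add ?_ h2)) h3)
            rw [norm_neg]
        _ = (1 + 2 * ρ * ‖Q‖ + (1 / 4 + c)) * ‖retract ρ x - retract ρ y‖ := by ring
        _ ≤ (1 + 2 * ρ * ‖Q‖ + (1 / 4 + c)) * (2 * ‖x - y‖) := by gcongr
        _ = 2 * (1 + 2 * ρ * ‖Q‖ + (1 / 4 + c)) * ‖x - y‖ := by ring
  set M : NNReal := ⟨ρ + ‖Q‖ * ρ * ρ + (1 / 4 + c) * ρ + D, by positivity⟩
  have hM : ∀ t, 0 ≤ t → ∀ x, ‖V t x‖ ≤ M := fun t ht x => by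
    have h1 := norm_retract_le hρ x
    have h2 : ‖Q (retract ρ x) (retract ρ x)‖ ≤ ‖Q‖ * ρ * ρ :=
      (Q.le_opNorm₂ _ _).trans (by gcongr)
    have h3 : ‖L t (retract ρ x)‖ ≤ (1 / 4 + c) * ρ :=
      ((L t).le_of_opNorm_le (hL' t ht) _).trans (by gcongr)
    have h4 : ‖F t‖ ≤ D := (hF t ht).trans (mul_le_of_le_one_right hD (hexp t ht))
    refine (norm_add_le _ _).trans (add_le_add ((norm_add_le _ _).trans (add_le_add
      ((norm_add_le _ _).trans (add_le_add ?_ h2)) h3)) h4)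
    rwa [norm_neg]
  have hex : ∀ n : ℕ, ∃ α : ℝ → H, α 0 = 0 ∧
      ∀ t ∈ Set.Icc (0 : ℝ) n, HasDerivWithinAt α (V t (α t)) (Set.Icc 0 (n : ℝ)) t := fun n => by
    have hn : (0 : ℝ) ≤ n := Nat.cast_nonneg n
    have hpl : IsPicardLindelof V (⟨0, le_rfl, hn⟩ : Set.Icc (0 : ℝ) n) (0 : H) (M * n) 0 M K :=
      { lipschitzOnWith := fun t ht => (hLip t ht.1).lipschitzOnWith
        continuousOn := fun x _ => by
          refine Continuous.continuousOn ?_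
          simp only [V, quadField]
          fun_prop
        norm_le := fun t ht x _ => hM t ht.1 x
        mul_max_le := by simp }
    exact hpl.exists_eq_forall_mem_Icc_hasDerivWithinAt₀
  choose α hα0 hα using hex
  have hαc : ∀ n, ContinuousOn (α n) (Set.Icc 0 (n : ℝ)) := fun n t ht =>
    (hα n t ht).continuousWithinAt
  have hαd : ∀ n : ℕ, ∀ t ∈ Set.Ioo (0 : ℝ) n, HasDerivAt (α n) (V t (α n t)) t := fun n t ht =>
    (hα n t (Set.Ioo_subset_Icc_self ht)).hasDerivAt (Icc_mem_nhds ht.1 ht.2)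
  -- the solutions on `[0, m]` and `[0, n]` agree where both are defined
  have huniq : ∀ m n : ℕ, m ≤ n → Set.EqOn (α m) (α n) (Set.Icc 0 (m : ℝ)) := fun m n hmn => by
    have hmn' : (m : ℝ) ≤ n := Nat.cast_le.2 hmn
    have hr : ∀ k : ℕ, m ≤ k → ∀ t ∈ Set.Ico (0 : ℝ) m,
        HasDerivWithinAt (α k) (V t (α k t)) (Set.Ici t) t := fun k hk t ht => by
      have hk' : (m : ℝ) ≤ k := Nat.cast_le.2 hk
      refine (hα k t ⟨ht.1, ht.2.le.trans hk'⟩).mono_of_mem_nhdsWithin ?_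
      refine mem_of_superset (Icc_mem_nhdsGE (ht.2.trans_le hk')) ?_
      exact Set.Icc_subset_Icc_left ht.1
    refine ODE_solution_unique_of_mem_Icc_right (K := K) (v := V) (s := fun _ => Set.univ)
      (fun t ht => (hLip t ht.1).lipschitzOnWith) (hαc m) (hr m le_rfl) (fun _ _ => trivial)
      ((hαc n).mono (Set.Icc_subset_Icc_right hmn')) (hr n hmn) (fun _ _ => trivial) ?_
    rw [hα0, hα0]
  have hnormsq : ∀ n : ℕ, ∀ t ∈ Set.Ioo (0 : ℝ) n, HasDerivAt (fun t => ‖α n t‖ ^ 2)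
      (2 * inner ℝ (α n t) (V t (α n t))) t := fun n t ht => (hαd n t ht).norm_sq
  -- the truncation is never active
  have hbd : ∀ n : ℕ, ∀ t ∈ Set.Icc (0 : ℝ) n, retract ρ (α n t) = α n t := fun n t ht => by
    refine retract_of_norm_le hρ ?_
    have h1 := bound_of_deriv_le (c := c) (D := D) ((hαc n).norm.pow 2) (hnormsq n)
      (by simp [hα0]) hc (fun _ => sq_nonneg _)
      (fun s hs => inner_quadField_retract_le hQ hρ hc (hL s hs.1.le) (hF s hs.1.le) _) ht
    refine abs_le_of_sq_le_sq' (h1.trans ?_) hρ.le |>.2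
    have h2 : 1 ≤ Real.exp (2 * c + 1) := Real.one_le_exp (by positivity)
    have h3 : D ^ 2 * Real.exp (2 * c + 1) ≤ D ^ 2 * Real.exp (2 * c + 1) ^ 2 := by
      gcongr; nlinarith
    have h4 : 0 ≤ D * Real.exp (2 * c + 1) := by positivity
    simp only [ρ]
    nlinarith
  have hdecay : ∀ n : ℕ, ∀ t ∈ Set.Icc (0 : ℝ) n,
      ‖α n t‖ ^ 2 ≤ 2 * D ^ 2 * Real.exp (2 * c) * Real.exp (-t) := fun n t ht =>
    decay_of_deriv_le ((hαc n).norm.pow 2) (hnormsq n) (by simp [hα0]) hc (fun _ => sq_nonneg _)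
      (fun s hs => by
        simp only [V, hbd n s (Set.Ioo_subset_Icc_self hs)]
        exact inner_quadField_le hQ (hL s hs.1.le) (hF s hs.1.le) _) ht
  have hz : ∀ (n : ℕ) (t : ℝ), 0 ≤ t → t ≤ n → α (⌈t⌉₊) t = α n t := fun n t h0 h1 =>
    huniq _ _ (Nat.ceil_le.2 h1) ⟨h0, Nat.le_ceil t⟩
  refine ⟨fun t => α ⌈t⌉₊ t, by simp [hα0], ?_, ?_, ?_⟩
  · intro t ht
    have ht' : (0 : ℝ) ≤ t := ht
    set n := ⌈t⌉₊ + 1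
    have hn : t < n := by simp only [n]; push_cast; linarith [Nat.le_ceil t]
    have h1 : ContinuousWithinAt (α n) (Set.Ici 0) t :=
      (hαc n t ⟨ht', hn.le⟩).mono_of_mem_nhdsWithin
        (by
          rw [← Set.Ici_inter_Iic]
          exact inter_mem self_mem_nhdsWithin (mem_nhdsWithin_of_mem_nhds (Iic_mem_nhds hn)))
    refine h1.congr_of_eventuallyEq ?_ (hz n t ht' hn.le)
    filter_upwards [self_mem_nhdsWithin, mem_nhdsWithin_of_mem_nhds (Iic_mem_nhds hn)]
      with s hs1 hs2 using hz n s hs1 hs2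
  · intro t ht
    set n := ⌈t⌉₊ + 1
    have hn : t < n := by simp only [n]; push_cast; linarith [Nat.le_ceil t]
    have h1 := hαd n t ⟨ht, hn⟩
    have h2 : V t (α n t) = quadField Q L F t (α n t) := by
      simp only [V, hbd n t ⟨ht.le, hn.le⟩]
    rw [h2] at h1
    simp only [hz n t ht.le hn.le]
    refine h1.congr_of_eventuallyEq ?_
    filter_upwards [Ioo_mem_nhds ht hn] with s hs using hz n s hs.1.le hs.2.le
  · intro t ht
    exact hdecay _ t ⟨ht, Nat.le_ceil t⟩

end ODE

/-! ### The equation as an ordinary differential equation in `L²` -/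

/-- The right-hand side of `u_t = -u - ∂(1 - ∂²)⁻¹(u²/2) + (1 - ∂²)⁻¹ f`. -/
noncomputable def rhs (u f : L2) : L2 :=
  -u - (1 / 2 : ℝ) • bilin u u + resolvent (resolventAdj f)

/-- Continuous curves in `L²` solving the integrated equation on `[0, ∞)` strongly. -/
structure IsMild (f u : ℝ → L2) : Prop where
  cont : ContinuousOn u (Set.Ici 0)
  eq : ∀ t, 0 ≤ t → u t = u 0 + ∫ s in (0 : ℝ)..t, rhs (u s) (f s)

lemma inner_bessel_rhs (ψ : 𝓢(ℝ, ℝ)) (u f : L2) :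
    inner ℝ ((bessel ψ).toLp 2) (rhs u f) =
      (∫ x : ℝ, f x * ψ x) + (∫ x : ℝ, (u x) ^ 2 / 2 * deriv ψ x) -
        ∫ x : ℝ, u x * (ψ x - deriv (deriv ψ) x) := by
  have h1 : inner ℝ ((bessel ψ).toLp 2) (resolvent (resolventAdj f)) = ∫ x : ℝ, f x * ψ x := by
    rw [bessel_eq_right, inner_resolvent, inner_resolventAdj, inner_toLp]
  have h2 : (∫ x : ℝ, (u x) ^ 2 / 2 * deriv ψ x) = (∫ x : ℝ, u x * u x * deriv ψ x) / 2 := by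
    rw [← integral_div]
    refine integral_congr_ae (ae_of_all _ fun x => ?_)
    simp only; ring
  rw [rhs, inner_add_right, inner_sub_right, inner_neg_right, real_inner_smul_right,
    inner_bessel_bilin, h1, h2, inner_toLp]
  simp only [bessel_apply]
  ring

/-- Forcings that are measurable and bounded for nonnegative times are integrable in time. -/
lemma intervalIntegrable_of_bounded {f : ℝ → L2} {δ : ℝ}
    (hf : AEStronglyMeasurable f (volume.restrict (Set.Ici (0 : ℝ))))
    (hδ : ∀ t, 0 ≤ t → ‖f t‖ ≤ δ) {a b : ℝ} (ha : 0 ≤ a) (hb : 0 ≤ b) :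
    IntervalIntegrable f volume a b := by
  have hsub : Set.uIoc a b ⊆ Set.Ici 0 := fun x hx => (le_min ha hb).trans hx.1.le
  rw [intervalIntegrable_iff]
  have hfin : IsFiniteMeasure (volume.restrict (Set.uIoc a b)) := ⟨by simp [Set.uIoc]⟩
  refine Integrable.of_bound (hf.mono_measure (Measure.restrict_mono_set _ hsub)) δ ?_
  filter_upwards [ae_restrict_mem measurableSet_uIoc] with x hx using hδ x (hsub hx)

section

variable {f u v : ℝ → L2}

lemma IsMild.intervalIntegrable_rhs (hf : ∀ t, 0 ≤ t → IntervalIntegrable f volume 0 t)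
    (hu : ContinuousOn u (Set.Ici 0)) {t : ℝ} (ht : 0 ≤ t) :
    IntervalIntegrable (fun s => rhs (u s) (f s)) volume 0 t := by
  have h1 : ContinuousOn (fun s => -u s - (1 / 2 : ℝ) • bilin (u s) (u s)) (Set.uIcc 0 t) := by
    have : ContinuousOn u (Set.uIcc 0 t) := hu.mono (by
      rw [Set.uIcc_of_le ht]; exact Set.Icc_subset_Ici_self)
    fun_prop
  refine h1.intervalIntegrable.add ?_
  have h2 := hf t ht
  rw [intervalIntegrable_iff] at h2 ⊢
  exact (resolvent.comp resolventAdj).integrable_comp h2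

lemma inner_integral_rhs (hf : ∀ t, 0 ≤ t → IntervalIntegrable f volume 0 t)
    (hu : ContinuousOn u (Set.Ici 0)) {t : ℝ} (ht : 0 ≤ t) (w : L2) :
    inner ℝ w (∫ s in (0 : ℝ)..t, rhs (u s) (f s)) =
      ∫ s in (0 : ℝ)..t, inner ℝ w (rhs (u s) (f s)) :=
  ((innerSL ℝ w).intervalIntegral_comp_comm (IsMild.intervalIntegrable_rhs hf hu ht)).symm

lemma IsSolution.continuousOn {ℓ : ℝ} (hℓ : 0 ≤ ℓ) {φ : L2} (h : IsSolution ℓ f φ u) :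
    ContinuousOn u (Set.Ici 0) := fun t ht => by
  rw [ContinuousWithinAt, tendsto_iff_edist_tendsto_0]
  refine tendsto_of_tendsto_of_tendsto_of_le_of_le tendsto_const_nhds (h.cont t ht)
    (fun _ => zero_le) fun s => ?_
  simp only [edist_eq_enorm_sub]
  exact enorm_le_sobolevNorm hℓ _

lemma IsSolution.isMild {ℓ : ℝ} (hℓ : 0 ≤ ℓ) (hf : ∀ t, 0 ≤ t → IntervalIntegrable f volume 0 t)
    {φ : L2} (h : IsSolution ℓ f φ u) : IsMild f u where
  cont := h.continuousOn hℓ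
  eq t ht := ext_of_inner_bessel fun ψ => by
    have hw := h.weak ψ t ht
    rw [inner_add_right, inner_integral_rhs hf (h.continuousOn hℓ) ht, ← sub_eq_iff_eq_add']
    simp only [inner_bessel_rhs]
    rw [← hw, inner_toLp, inner_toLp]
    rfl

lemma IsMild.isSolution {ℓ : ℝ} (hf : ∀ t, 0 ≤ t → IntervalIntegrable f volume 0 t)
    (h : IsMild f u) (hmem : ∀ t, 0 ≤ t → MemH ℓ (u t))
    (hcont : ∀ t₀ : ℝ, 0 ≤ t₀ →
      Tendsto (fun t => sobolevNorm ℓ (u t - u t₀)) (𝓝[Set.Ici 0] t₀) (𝓝 0)) :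
    IsSolution ℓ f (u 0) u where
  memH := hmem
  cont := hcont
  init := rfl
  weak ψ t ht := by
    have h1 := congrArg (fun w => inner ℝ ((bessel ψ).toLp 2 volume : L2) w) (h.eq t ht)
    simp only [inner_add_right] at h1
    rw [inner_integral_rhs hf h.cont ht, ← sub_eq_iff_eq_add'] at h1
    simp only [inner_bessel_rhs] at h1
    rw [inner_toLp, inner_toLp] at h1
    exact h1

/-- Uniqueness in `L²`, by Gronwall's inequality. -/
lemma IsMild.unique (hf : ∀ t, 0 ≤ t → IntervalIntegrable f volume 0 t)
    (hu : IsMild f u) (hv : IsMild f v) (h0 : u 0 = v 0) {t : ℝ} (ht : 0 ≤ t) : u t = v t := by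
  set G : ℝ → L2 := fun s => -(u s - v s) -
    (1 / 2 : ℝ) • (bilin (u s) (u s - v s) + bilin (u s - v s) (v s))
  have hGc : ContinuousOn G (Set.Ici 0) := by
    have h1 := hu.cont
    have h2 := hv.cont
    fun_prop
  have hGe : Continuous fun s => G (max s 0) :=
    hGc.comp_continuous (by fun_prop) fun s => le_max_right s 0
  have hd : ∀ s, 0 ≤ s → u s - v s = ∫ r in (0 : ℝ)..s, G (max r 0) := fun s hs => by
    rw [hu.eq s hs, hv.eq s hs, h0, add_sub_add_left_eq_sub,
      ← intervalIntegral.integral_sub (IsMild.intervalIntegrable_rhs hf hu.cont hs)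
        (IsMild.intervalIntegrable_rhs hf hv.cont hs)]
    refine intervalIntegral.integral_congr fun r hr => ?_
    rw [Set.uIcc_of_le hs] at hr
    simp only [G, rhs, max_eq_left hr.1, map_sub, _root_.sub_apply]
    module
  obtain ⟨Mu, hMu⟩ := isCompact_Icc.exists_bound_of_continuousOn
    (hu.cont.mono (Set.Icc_subset_Ici_self : Set.Icc 0 t ⊆ _))
  obtain ⟨Mv, hMv⟩ := isCompact_Icc.exists_bound_of_continuousOn
    (hv.cont.mono (Set.Icc_subset_Ici_self : Set.Icc 0 t ⊆ _))
  have hzero := eq_zero_of_abs_deriv_le_mul_abs_self_of_eq_zero_right (a := 0) (b := t)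
    (f := fun s => u s - v s) (f' := G) (K := 1 + 1 / 2 * (Mu + Mv))
    ((hu.cont.sub hv.cont).mono Set.Icc_subset_Ici_self) (fun s hs => by
      have h1 := (hGe.integral_hasStrictDerivAt 0 s).hasDerivAt.hasDerivWithinAt
        (s := Set.Ici s)
      rw [max_eq_left hs.1] at h1
      exact h1.congr (fun r hr => hd r (hs.1.trans hr)) (hd s hs.1)) (by simp [h0])
    (fun s hs => by
      have hs' : s ∈ Set.Icc 0 t := ⟨hs.1, hs.2.le⟩
      have b1 : ‖bilin (u s) (u s - v s)‖ ≤ Mu * ‖u s - v s‖ :=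
        (norm_bilin_le _ _).trans (by gcongr; exact hMu s hs')
      have b2 : ‖bilin (u s - v s) (v s)‖ ≤ ‖u s - v s‖ * Mv :=
        (norm_bilin_le _ _).trans (by gcongr; exact hMv s hs')
      calc ‖G s‖ ≤ ‖u s - v s‖ + 1 / 2 * (Mu * ‖u s - v s‖ + ‖u s - v s‖ * Mv) := by
            refine (norm_sub_le _ _).trans (add_le_add (norm_neg _).le ?_)
            rw [norm_smul]
            refine mul_le_mul (by norm_num) ((norm_add_le _ _).trans (add_le_add b1 b2))
              (norm_nonneg _) (by norm_num)
        _ = _ := by ring)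
  exact sub_eq_zero.1 (hzero t ⟨ht, le_rfl⟩)

end

/-! ### Duhamel's formula -/

section Duhamel

variable {E : Type*} [NormedAddCommGroup E] [NormedSpace ℝ E]
variable {n : ℝ → E} {ν : ℝ}

lemma intervalIntegrable_exp_smul (hn : AEStronglyMeasurable n) (hν : ∀ t, ‖n t‖ ≤ ν) (a b : ℝ) :
    IntervalIntegrable (fun s => Real.exp s • n s) volume a b := by
  have h : IntervalIntegrable n volume a b := by
    rw [intervalIntegrable_iff]
    exact Measure.integrableOn_of_bounded (M := ν) (by simp) hn (ae_of_all _ hν)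
  exact h.continuousOn_smul Real.continuous_exp.continuousOn

/-- An integration by parts, proved by Fubini's theorem since `n` need not be continuous. -/
lemma integral_exp_neg_smul_primitive [CompleteSpace E] (hn : AEStronglyMeasurable n)
    (hν : ∀ t, ‖n t‖ ≤ ν) {t : ℝ} (ht : 0 ≤ t) :
    ∫ s in (0 : ℝ)..t, Real.exp (-s) • ∫ r in (0 : ℝ)..s, Real.exp r • n r =
      (∫ r in (0 : ℝ)..t, n r) - Real.exp (-t) • ∫ r in (0 : ℝ)..t, Real.exp r • n r := by
  set μ := (volume : Measure ℝ).restrict (Set.Ioc 0 t)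
  set k : ℝ → ℝ → E := fun s r =>
    (Set.Iic s).indicator (fun r => (Real.exp (-s) * Real.exp r) • n r) r
  have hS : MeasurableSet {p : ℝ × ℝ | p.2 ≤ p.1} := measurableSet_le measurable_snd measurable_fst
  have hk : Function.uncurry k = {p : ℝ × ℝ | p.2 ≤ p.1}.indicator
      fun p => (Real.exp (-p.1) * Real.exp p.2) • n p.2 := by
    ext ⟨s, r⟩
    simp only [Function.uncurry_apply_pair, k]
    by_cases h : r ≤ s
    · rw [Set.indicator_of_mem (by simpa using h), Set.indicator_of_mem (by simpa using h)]
    · rw [Set.indicator_of_notMem (by simpa using h), Set.indicator_of_notMem (by simpa using h)]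
  have hint : Integrable (Function.uncurry k) (μ.prod μ) := by
    rw [hk]
    refine Integrable.of_bound (C := 1 * Real.exp t * ν) ?_ ?_
    · refine AEStronglyMeasurable.indicator ?_ hS
      exact AEStronglyMeasurable.smul (Measurable.aestronglyMeasurable (by fun_prop))
        hn.restrict.comp_snd
    · have h1 : ∀ᵐ p ∂(μ.prod μ), p ∈ Set.Ioc 0 t ×ˢ Set.Ioc 0 t := by
        rw [Measure.prod_restrict]
        exact ae_restrict_mem (measurableSet_Ioc.prod measurableSet_Ioc)
      filter_upwards [h1] with p hp
      refine (norm_indicator_le_norm_self _ _).trans ?_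
      rw [norm_smul, Real.norm_of_nonneg (by positivity)]
      have e1 : Real.exp (-p.1) ≤ 1 := Real.exp_le_one_iff.2 (by linarith [hp.1.1])
      have e2 : Real.exp p.2 ≤ Real.exp t := Real.exp_le_exp.2 hp.2.2
      gcongr
      exact hν _
  have hswap := integral_integral_swap hint
  rw [intervalIntegral.integral_of_le ht]
  calc _ = ∫ s, ∫ r, k s r ∂μ ∂μ := by
        refine integral_congr_ae ?_
        filter_upwards [ae_restrict_mem measurableSet_Ioc] with s hs
        simp only [k]
        rw [integral_indicator measurableSet_Iic, Measure.restrict_restrict measurableSet_Iic,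
          intervalIntegral.integral_of_le hs.1.le, ← integral_smul]
        have e : Set.Iic s ∩ Set.Ioc 0 t = Set.Ioc 0 s := by
          ext r; simp only [Set.mem_inter_iff, Set.mem_Iic, Set.mem_Ioc]
          have := hs.2
          constructor
          · rintro ⟨h1, h2, -⟩; exact ⟨h2, h1⟩
          · rintro ⟨h1, h2⟩; exact ⟨h2, h1, h2.trans this⟩
        rw [e]
        simp only [smul_smul]
    _ = ∫ r, ∫ s, k s r ∂μ ∂μ := hswap
    _ = ∫ r, (n r - Real.exp (-t) • Real.exp r • n r) ∂μ := by
        refine integral_congr_ae ?_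
        filter_upwards [ae_restrict_mem measurableSet_Ioc] with r hr
        have e0 : ∀ s, k s r = (Set.Ici r).indicator (fun s => Real.exp (-s)) s •
            (Real.exp r • n r) := fun s => by
          simp only [k]
          by_cases h : r ≤ s
          · rw [Set.indicator_of_mem (by simpa using h), Set.indicator_of_mem (by simpa using h),
              smul_smul]
          · rw [Set.indicator_of_notMem (by simpa using h),
              Set.indicator_of_notMem (by simpa using h), zero_smul]
        simp only [e0]
        rw [integral_smul_const, integral_indicator measurableSet_Ici,
          Measure.restrict_restrict measurableSet_Ici]
        have e : Set.Ici r ∩ Set.Ioc 0 t = Set.Icc r t := by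
          ext s; simp only [Set.mem_inter_iff, Set.mem_Ici, Set.mem_Ioc, Set.mem_Icc]
          have := hr.1
          constructor
          · rintro ⟨h1, -, h2⟩; exact ⟨h1, h2⟩
          · rintro ⟨h1, h2⟩; exact ⟨h1, this.trans_le h1, h2⟩
        rw [e, integral_Icc_eq_integral_Ioc, ← intervalIntegral.integral_of_le hr.2]
        have e2 : ∫ s in r..t, Real.exp (-s) = Real.exp (-r) - Real.exp (-t) := by
          rw [intervalIntegral.integral_comp_neg (fun s => Real.exp s), integral_exp]
        rw [e2, sub_smul, smul_smul (Real.exp (-r)), ← Real.exp_add, neg_add_cancel,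
          Real.exp_zero, one_smul]
    _ = _ := by
        have i1 : Integrable n μ :=
          Measure.integrableOn_of_bounded (M := ν) (by simp) hn (ae_of_all _ hν)
        have i2 : Integrable (fun r => Real.exp r • n r) μ :=
          (intervalIntegrable_iff_integrableOn_Ioc_of_le ht).1
            (intervalIntegrable_exp_smul hn hν 0 t)
        have i3 : Integrable (fun r => Real.exp (-t) • Real.exp r • n r) μ := i2.smul _
        rw [integral_sub i1 i3, integral_smul,
          intervalIntegral.integral_of_le ht, intervalIntegral.integral_of_le ht]

/-- Duhamel's formula `e^{-t} (c + ∫₀ᵗ e^s n(s) ds)` for the solution of `y' = -y + n`,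
`y(0) = c`, continued by the constant `c` to negative times. -/
noncomputable def duhamel (c : E) (n : ℝ → E) (t : ℝ) : E :=
  Real.exp (-max t 0) • (c + ∫ s in (0 : ℝ)..max t 0, Real.exp s • n s)

lemma continuous_duhamel (hn : AEStronglyMeasurable n) (hν : ∀ t, ‖n t‖ ≤ ν) (c : E) :
    Continuous (duhamel c n) := by
  have h := intervalIntegral.continuous_primitive (intervalIntegrable_exp_smul hn hν) 0
  have h2 : Continuous fun t : ℝ => max t 0 := by fun_prop
  exact (Real.continuous_exp.comp h2.neg).smul (continuous_const.add (h.comp h2))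

lemma duhamel_zero (c : E) (n : ℝ → E) : duhamel c n 0 = c := by simp [duhamel]

lemma norm_integral_exp_smul_le (hν : ∀ t, ‖n t‖ ≤ ν) {t : ℝ} (ht : 0 ≤ t) :
    ‖∫ s in (0 : ℝ)..t, Real.exp s • n s‖ ≤ ν * (Real.exp t - 1) := by
  have h := intervalIntegral.norm_integral_le_of_norm_le ht (g := fun s => Real.exp s * ν)
    (f := fun s => Real.exp s • n s) (μ := volume)
    (ae_of_all _ fun s _ => by
      rw [norm_smul, Real.norm_of_nonneg (Real.exp_pos s).le]
      exact mul_le_mul_of_nonneg_left (hν s) (Real.exp_pos s).le)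
    (Continuous.intervalIntegrable (by fun_prop) _ _)
  rwa [intervalIntegral.integral_mul_const, integral_exp, Real.exp_zero, mul_comm] at h

lemma norm_duhamel_le (hν : ∀ t, ‖n t‖ ≤ ν) {c : E} (hc : ‖c‖ ≤ ν) (t : ℝ) :
    ‖duhamel c n t‖ ≤ ν := by
  set s := max t 0
  have h := norm_integral_exp_smul_le hν (le_max_right t 0)
  rw [duhamel, norm_smul, Real.norm_of_nonneg (Real.exp_pos _).le]
  calc _ ≤ Real.exp (-s) * (ν + ν * (Real.exp s - 1)) := by
        gcongr; exact (norm_add_le _ _).trans (add_le_add hc h)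
    _ = ν * (Real.exp (-s) * Real.exp s) := by ring
    _ = ν := by rw [← Real.exp_add, neg_add_cancel, Real.exp_zero, mul_one]

lemma duhamel_eq [CompleteSpace E] (hn : AEStronglyMeasurable n) (hν : ∀ t, ‖n t‖ ≤ ν)
    (c : E) {t : ℝ} (ht : 0 ≤ t) :
    duhamel c n t = c + ∫ s in (0 : ℝ)..t, (-duhamel c n s + n s) := by
  have hni : IntervalIntegrable n volume 0 t := by
    rw [intervalIntegrable_iff]
    exact Measure.integrableOn_of_bounded (M := ν) (by simp) hn (ae_of_all _ hν)
  have hdi : IntervalIntegrable (fun s => -duhamel c n s) volume 0 t :=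
    (continuous_duhamel hn hν c).neg.intervalIntegrable _ _
  rw [intervalIntegral.integral_add hdi hni, intervalIntegral.integral_neg]
  have e1 : ∫ s in (0 : ℝ)..t, duhamel c n s =
      ∫ s in (0 : ℝ)..t,
        (Real.exp (-s) • c + Real.exp (-s) • ∫ r in (0 : ℝ)..s, Real.exp r • n r) := by
    refine intervalIntegral.integral_congr fun s hs => ?_
    rw [Set.uIcc_of_le ht] at hs
    simp only [duhamel, max_eq_left hs.1, smul_add]
  have hp := intervalIntegral.continuous_primitive (intervalIntegrable_exp_smul hn hν) 0
  rw [e1, intervalIntegral.integral_add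
    (Continuous.intervalIntegrable (by fun_prop) _ _)
    (Continuous.intervalIntegrable (by fun_prop) _ _),
    integral_exp_neg_smul_primitive hn hν ht, intervalIntegral.integral_smul_const,
    intervalIntegral.integral_comp_neg (fun s => Real.exp s), integral_exp, duhamel,
    max_eq_left ht, neg_zero, Real.exp_zero]
  module

end Duhamel

/-! ### The periodic solution -/

section

variable {E : Type*} [NormedAddCommGroup E] [NormedSpace ℝ E] {n : ℝ → E} {ν θ : ℝ}

/-- The initial value for which the solution of `y' = -y + n` returns to it at time `θ`. -/
noncomputable def periodicDatum (θ : ℝ) (n : ℝ → E) : E :=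
  (Real.exp θ - 1)⁻¹ • ∫ s in (0 : ℝ)..θ, Real.exp s • n s

lemma norm_periodicDatum_le (hθ : 0 < θ) (hν : ∀ t, ‖n t‖ ≤ ν) : ‖periodicDatum θ n‖ ≤ ν := by
  have h1 : 0 < Real.exp θ - 1 := sub_pos.2 (Real.one_lt_exp_iff.2 hθ)
  rw [periodicDatum, norm_smul, norm_inv, Real.norm_of_nonneg h1.le, inv_mul_le_iff₀ h1, mul_comm]
  exact norm_integral_exp_smul_le hν hθ.le

lemma duhamel_periodicDatum (hθ : 0 < θ) (n : ℝ → E) :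
    duhamel (periodicDatum θ n) n θ = periodicDatum θ n := by
  have h1 : Real.exp θ - 1 ≠ 0 := (sub_pos.2 (Real.one_lt_exp_iff.2 hθ)).ne'
  have h2 : ∫ s in (0 : ℝ)..θ, Real.exp s • n s = (Real.exp θ - 1) • periodicDatum θ n := by
    rw [periodicDatum, smul_inv_smul₀ h1]
  rw [duhamel, max_eq_left hθ.le, h2, ← one_smul ℝ (periodicDatum θ n), smul_smul _ (1 : ℝ),
    ← add_smul, smul_smul, mul_one, add_sub_cancel, ← Real.exp_add, neg_add_cancel, Real.exp_zero]

lemma duhamel_sub {m : ℝ → E} (hn : AEStronglyMeasurable n) (hν : ∀ t, ‖n t‖ ≤ ν)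
    (hm : AEStronglyMeasurable m) (hμ : ∀ t, ‖m t‖ ≤ ν) (c d : E) (t : ℝ) :
    duhamel c n t - duhamel d m t = duhamel (c - d) (fun s => n s - m s) t := by
  simp only [duhamel, smul_sub]
  rw [intervalIntegral.integral_sub (intervalIntegrable_exp_smul hn hν _ _)
    (intervalIntegrable_exp_smul hm hμ _ _)]
  module

lemma periodicDatum_sub {m : ℝ → E} (hn : AEStronglyMeasurable n) (hν : ∀ t, ‖n t‖ ≤ ν)
    (hm : AEStronglyMeasurable m) (hμ : ∀ t, ‖m t‖ ≤ ν) :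
    periodicDatum θ n - periodicDatum θ m = periodicDatum θ (fun s => n s - m s) := by
  simp only [periodicDatum, smul_sub]
  rw [intervalIntegral.integral_sub (intervalIntegrable_exp_smul hn hν _ _)
    (intervalIntegrable_exp_smul hm hμ _ _), smul_sub]

end

lemma norm_half_lifted_sub_le (x y : L2) :
    ‖(1 / 2 : ℝ) • lifted (resolvent x) x - (1 / 2 : ℝ) • lifted (resolvent y) y‖ ≤
      (‖x‖ + ‖y‖) * ‖x - y‖ := by
  have e : (1 / 2 : ℝ) • lifted (resolvent x) x - (1 / 2 : ℝ) • lifted (resolvent y) y =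
      (1 / 2 : ℝ) • (lifted (resolvent x) (x - y) + lifted (resolvent (x - y)) y) := by
    simp only [map_sub, _root_.sub_apply]
    module
  have b1 := norm_lifted_le (resolvent x) (x - y)
  have b2 := norm_lifted_le (resolvent (x - y)) y
  have b3 : ‖resolvent x‖ * ‖x - y‖ ≤ ‖x‖ * ‖x - y‖ := by gcongr; exact norm_resolvent_le x
  have b4 : ‖resolvent (x - y)‖ * ‖y‖ ≤ ‖x - y‖ * ‖y‖ := by gcongr; exact norm_resolvent_le _
  rw [e, norm_smul, Real.norm_of_nonneg (by norm_num)]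
  linarith [norm_add_le (lifted (resolvent x) (x - y)) (lifted (resolvent (x - y)) y)]

lemma norm_half_lifted_le (x : L2) : ‖(1 / 2 : ℝ) • lifted (resolvent x) x‖ ≤ ‖x‖ ^ 2 := by
  have := norm_half_lifted_sub_le x 0
  simpa [sq] using this

/-- For a small forcing, the equation `η' = -η - ½ lifted (Pη) η + (1 - ∂)⁻¹ f`, which `Pη = u`
transforms into the equation for `u`, has a small solution with `η(θ) = η(0)`: it is the fixed
point of a contraction on a ball of bounded continuous curves. -/
lemma exists_isMild_periodic {θ : ℝ} (hθ : 0 < θ) {f : ℝ → L2}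
    (hf : AEStronglyMeasurable f (volume.restrict (Set.Ici (0 : ℝ))))
    (hδ : ∀ t, 0 ≤ t → ‖f t‖ ≤ 1 / 32) :
    ∃ η : ℝ → L2, Continuous η ∧ (∀ t, ‖η t‖ ≤ 1 / 16) ∧ η θ = η 0 ∧
      IsMild f fun t => resolvent (η t) := by
  -- the values of `f` at negative times are unrestricted
  set g : ℝ → L2 := (Set.Ici 0).indicator f with hg
  have hgm : AEStronglyMeasurable g :=
    (aestronglyMeasurable_indicator_iff measurableSet_Ici).2 hf
  have hgb : ∀ t, ‖g t‖ ≤ 1 / 32 := fun t => by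
    by_cases h : 0 ≤ t
    · rw [hg, Set.indicator_of_mem (by simpa using h)]; exact hδ t h
    · rw [hg, Set.indicator_of_notMem (by simpa using h)]; norm_num
  set N : BoundedContinuousFunction ℝ L2 → ℝ → L2 := fun η s =>
    -((1 / 2 : ℝ) • lifted (resolvent (η s)) (η s)) + resolventAdj (g s) with hN
  have hNm : ∀ η, AEStronglyMeasurable (N η) := fun η => by
    have hη := η.continuous
    have h1 : Continuous fun s => -((1 / 2 : ℝ) • lifted (resolvent (η s)) (η s)) := by fun_prop
    exact h1.aestronglyMeasurable.add (resolventAdj.continuous.comp_aestronglyMeasurable hgm)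
  have hNb : ∀ η s, ‖N η s‖ ≤ ‖η‖ ^ 2 + 1 / 32 := fun η s => by
    refine (norm_add_le _ _).trans (add_le_add ?_ ((norm_resolventAdj_le _).trans (hgb s)))
    rw [norm_neg]
    refine (norm_half_lifted_le _).trans ?_
    gcongr
    exact η.norm_coe_le_norm s
  set Φ : BoundedContinuousFunction ℝ L2 → BoundedContinuousFunction ℝ L2 := fun η =>
    BoundedContinuousFunction.ofNormedAddCommGroup (duhamel (periodicDatum θ (N η)) (N η))
      (continuous_duhamel (hNm η) (hNb η) _) _
      (norm_duhamel_le (hNb η) (norm_periodicDatum_le hθ (hNb η))) with hΦ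
  set B : Set (BoundedContinuousFunction ℝ L2) := Metric.closedBall 0 (1 / 16) with hB
  have hmem : ∀ η ∈ B, ‖η‖ ≤ 1 / 16 := fun η h => by simpa [hB] using h
  -- the nonlinear term is at most `‖η‖²`, and `(1 / 16)² + 1 / 32 ≤ 1 / 16`
  have hmaps : Set.MapsTo Φ B B := fun η h => by
    have h1 := hmem η h
    rw [hB, mem_closedBall_zero_iff, BoundedContinuousFunction.norm_le (by norm_num)]
    intro t
    refine (norm_duhamel_le (hNb η) (norm_periodicDatum_le hθ (hNb η)) t).trans ?_
    nlinarith [norm_nonneg η]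
  have hcontr : ContractingWith (1 / 8) (hmaps.restrict Φ B B) := by
    refine ⟨by rw [div_lt_one (by norm_num)]; norm_num, LipschitzWith.of_dist_le_mul ?_⟩
    rintro ⟨x, hx⟩ ⟨y, hy⟩
    change dist (Φ x) (Φ y) ≤ _ * dist x y
    have hx' := hmem x hx
    have hy' := hmem y hy
    rw [dist_eq_norm, dist_eq_norm]
    have hb : ∀ z ∈ B, ∀ s, ‖N z s‖ ≤ 1 / 16 := fun z hz s =>
      (hNb z s).trans (by nlinarith [norm_nonneg z, hmem z hz])
    have hd : ∀ s, ‖N x s - N y s‖ ≤ 1 / 8 * ‖x - y‖ := fun s => by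
      have e : N x s - N y s = -((1 / 2 : ℝ) • lifted (resolvent (x s)) (x s) -
          (1 / 2 : ℝ) • lifted (resolvent (y s)) (y s)) := by
        simp only [hN]; abel
      rw [e, norm_neg]
      refine (norm_half_lifted_sub_le _ _).trans ?_
      have h1 := (x.norm_coe_le_norm s).trans hx'
      have h2 := (y.norm_coe_le_norm s).trans hy'
      have h3 : ‖x s - y s‖ ≤ ‖x - y‖ := (x - y).norm_coe_le_norm s
      gcongr
      linarith
    refine (BoundedContinuousFunction.norm_le (by positivity)).2 fun t => ?_
    have e : (Φ x - Φ y) t = duhamel (periodicDatum θ (N x)) (N x) t -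
      duhamel (periodicDatum θ (N y)) (N y) t := rfl
    rw [e, duhamel_sub (hNm x) (hb x hx) (hNm y) (hb y hy),
      periodicDatum_sub (hNm x) (hb x hx) (hNm y) (hb y hy)]
    exact (norm_duhamel_le hd (norm_periodicDatum_le hθ hd) t).trans (by simp)
  obtain ⟨η, hη, hfix, -⟩ := hcontr.exists_fixedPoint' Metric.isClosed_closedBall.isComplete hmaps
    (x := 0) (by simp [hB]) (edist_ne_top _ _)
  have hval : ∀ t, η t = duhamel (periodicDatum θ (N η)) (N η) t := fun t =>
    (congrArg (fun ζ : BoundedContinuousFunction ℝ L2 => ζ t) hfix).symm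
  refine ⟨η, η.continuous, fun t => (η.norm_coe_le_norm t).trans (hmem η hη), ?_,
    (resolvent.continuous.comp η.continuous).continuousOn, fun t ht => ?_⟩
  · rw [hval, hval, duhamel_zero, duhamel_periodicDatum hθ]
  · have h1 : η t = η 0 + ∫ s in (0 : ℝ)..t, (-η s + N η s) := by
      rw [hval t, hval 0, duhamel_zero, duhamel_eq (hNm η) (hNb η) _ ht]
      simp only [hval]
    have hi : IntervalIntegrable (fun s => -η s + N η s) volume 0 t := by
      have h2 : IntervalIntegrable (N η) volume 0 t := by
        rw [intervalIntegrable_iff]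
        exact Measure.integrableOn_of_bounded (by simp) (hNm η) (ae_of_all _ (hNb η))
      exact (η.continuous.neg.intervalIntegrable 0 t).add h2
    have h2 := congrArg resolvent h1
    rw [map_add, ← resolvent.intervalIntegral_comp_comm hi] at h2
    rw [h2]
    congr 1
    refine intervalIntegral.integral_congr fun s hs => ?_
    rw [Set.uIcc_of_le ht] at hs
    have hgs : g s = f s := by rw [hg, Set.indicator_of_mem (Set.mem_Ici.2 hs.1)]
    simp only [hN, hgs, rhs, map_add, map_neg, map_smul, ← bilin_resolvent]
    abel

/-! ### Solutions with arbitrary data near the periodic one -/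

/-- The function `∂(1 - ∂²)⁻¹(w²/2)` is bounded, with an `L^∞` bound that is quadratic in `‖w‖`. -/
lemma exists_bilin_ae_eq_top (w : L2) : ∃ b : Lp ℝ ∞ (volume : Measure ℝ),
    (((1 / 2 : ℝ) • bilin w w : L2) : ℝ → ℝ) =ᵐ[volume] b ∧ ‖b‖ ≤ ‖w‖ ^ 2 / 2 := by
  set h := (ContinuousLinearMap.mul ℝ ℝ).holder (μ := volume) 1 w w
  refine ⟨(1 / 2 : ℝ) • flux ∞ h, ?_, ?_⟩
  · have h1 : (bilin w w : ℝ → ℝ) =ᵐ[volume] flux ∞ h :=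
      (coeFn_convCLM 2 unitKernel_fluxKernel h).trans
        (coeFn_convCLM ∞ unitKernel_fluxKernel h).symm
    filter_upwards [Lp.coeFn_smul (1 / 2 : ℝ) (bilin w w), Lp.coeFn_smul (1 / 2 : ℝ) (flux ∞ h), h1]
      with x e1 e2 e3
    rw [e1, e2, Pi.smul_apply, Pi.smul_apply, e3]
  · have h2 : ‖h‖ ≤ ‖w‖ * ‖w‖ := norm_holder_one_le w w
    rw [norm_smul, Real.norm_of_nonneg (by norm_num)]
    linarith [norm_flux_le ∞ h]

lemma abs_exp_sub_exp_le {t : ℝ} (ht : 0 ≤ t) :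
    |Real.exp (-(2 * t)) - Real.exp (-t)| ≤ Real.exp (-t) := by
  have h1 : Real.exp (-(2 * t)) ≤ Real.exp (-t) := Real.exp_le_exp.2 (by linarith)
  rw [abs_of_nonpos (by linarith)]
  linarith [Real.exp_pos (-(2 * t))]

/-- The part `e^{-t} w + (e^{-2t} - e^{-t}) ∂(1 - ∂²)⁻¹(w²/2)` of the deviation from the periodic
solution that need not lie in `H¹`. It solves `a' = -a - e^{-2t} ∂(1 - ∂²)⁻¹(w²/2)`, `a(0) = w`. -/
noncomputable def roughPart (w : L2) (t : ℝ) : L2 :=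
  Real.exp (-t) • w + (Real.exp (-(2 * t)) - Real.exp (-t)) • ((1 / 2 : ℝ) • bilin w w)

lemma continuous_roughPart (w : L2) : Continuous (roughPart w) := by
  unfold roughPart; fun_prop

lemma roughPart_zero (w : L2) : roughPart w 0 = w := by simp [roughPart]

lemma hasDerivAt_roughPart (w : L2) (t : ℝ) : HasDerivAt (roughPart w)
    (-roughPart w t - Real.exp (-(2 * t)) • ((1 / 2 : ℝ) • bilin w w)) t := by
  have h1 : HasDerivAt (fun t : ℝ => Real.exp (-t)) (-Real.exp (-t)) t := by
    simpa using (hasDerivAt_neg t).exp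
  have h2 : HasDerivAt (fun t : ℝ => Real.exp (-(2 * t))) (-2 * Real.exp (-(2 * t))) t := by
    have := ((hasDerivAt_id t).const_mul 2).neg.exp
    simpa [mul_comm] using this
  have h3 := (h1.smul_const w).add ((h2.sub h1).smul_const ((1 / 2 : ℝ) • bilin w w))
  refine h3.congr_deriv ?_
  simp only [roughPart]
  module

lemma norm_half_bilin_self_le (w : L2) : ‖(1 / 2 : ℝ) • bilin w w‖ ≤ ‖w‖ ^ 2 / 2 := by
  rw [norm_smul, Real.norm_of_nonneg (by norm_num)]
  linarith [norm_bilin_le w w]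

lemma norm_roughPart_le {w : L2} {t : ℝ} (ht : 0 ≤ t) :
    ‖roughPart w t‖ ≤ (‖w‖ + ‖w‖ ^ 2 / 2) * Real.exp (-t) := by
  have h1 : ‖(Real.exp (-(2 * t)) - Real.exp (-t)) • ((1 / 2 : ℝ) • bilin w w)‖ ≤
      Real.exp (-t) * (‖w‖ ^ 2 / 2) := by
    rw [norm_smul]
    exact mul_le_mul (abs_exp_sub_exp_le ht) (norm_half_bilin_self_le w) (norm_nonneg _)
      (Real.exp_pos _).le
  have h2 : ‖Real.exp (-t) • w‖ = Real.exp (-t) * ‖w‖ := by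
    rw [norm_smul, Real.norm_of_nonneg (Real.exp_pos _).le]
  refine (norm_add_le _ _).trans ?_
  linarith

lemma rhs_add_sub_rhs (u y f : L2) :
    rhs (u + y) f - rhs u f = -y - bilin u y - (1 / 2 : ℝ) • bilin y y := by
  simp only [rhs, map_add, _root_.add_apply, bilin_comm y u]
  module

/-- Applied to `z'`, the operator `(1 + ∂)⁻¹` gives what is missing in `a'` for `a + (1 + ∂)⁻¹ z` to
solve the equation of the deviations from `(1 + ∂)⁻¹ η`. -/
lemma resolvent_smoothField {a w k η z : L2} (f : L2) {b : Lp ℝ ∞ (volume : Measure ℝ)} {e c : ℝ}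
    (hb : k =ᵐ[volume] b) (hk : bilin w w = (2 : ℝ) • k) (ha : a = e • w + c • k) :
    resolvent (-z + -((1 / 2 : ℝ) • lifted (resolvent z) z) + -lifted (a + resolvent η) z +
      (-((e * c) • liftedFlux (mulTop w b) + (c ^ 2 / 2) • liftedFlux (mulTop k b)) -
        lifted a η)) =
      rhs (resolvent η + (a + resolvent z)) f - rhs (resolvent η) f - (-a - e ^ 2 • k) := by
  have h1 : bilin a a = (2 * e ^ 2) • k + (2 * (e * c)) • bilin w k + (c ^ 2) • bilin k k := by
    rw [ha]
    simp only [map_add, map_smul, _root_.add_apply, _root_.smul_apply, bilin_comm k w, hk]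
    module
  rw [rhs_add_sub_rhs]
  simp only [map_add, map_sub, map_neg, map_smul, _root_.add_apply, ← bilin_resolvent,
    ← bilin_eq_of_ae hb, h1, bilin_comm (resolvent z) a, bilin_comm (resolvent η) a]
  module

/-- The forcing in the equation of the smooth part is of size `O(‖w‖ e^{-t})`. -/
lemma norm_forcing_le {w k x : L2} {b : Lp ℝ ∞ (volume : Measure ℝ)} {ρ t : ℝ} (hw : ‖w‖ ≤ ρ)
    (hkn : ‖k‖ ≤ ‖w‖ ^ 2 / 2) (hbn : ‖b‖ ≤ ‖w‖ ^ 2 / 2) (hη : ‖x‖ ≤ 1 / 16) (ht : 0 ≤ t) :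
    ‖-((Real.exp (-t) * (Real.exp (-(2 * t)) - Real.exp (-t))) • liftedFlux (mulTop w b) +
      ((Real.exp (-(2 * t)) - Real.exp (-t)) ^ 2 / 2) • liftedFlux (mulTop k b)) -
        lifted (roughPart w t) x‖ ≤
      (ρ ^ 2 + ρ ^ 3 / 4 + (1 + ρ / 2) / 8) * ‖w‖ * Real.exp (-t) := by
  have hρ : 0 ≤ ρ := (norm_nonneg w).trans hw
  have hct : |Real.exp (-(2 * t)) - Real.exp (-t)| ≤ Real.exp (-t) := abs_exp_sub_exp_le ht
  have he1 : Real.exp (-t) ≤ 1 := Real.exp_le_one_iff.2 (by linarith)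
  have he0 := Real.exp_pos (-t)
  set e := Real.exp (-t)
  set c := Real.exp (-(2 * t)) - e
  have n0 := norm_nonneg w
  have b1 : ‖liftedFlux (mulTop w b)‖ ≤ ‖w‖ * ρ ^ 2 := by
    have h1 := norm_liftedFlux_le (mulTop w b)
    have h2 := norm_mulTop_le w b
    have h3 : ‖w‖ * ‖b‖ ≤ ‖w‖ * (ρ ^ 2 / 2) := by gcongr; exact hbn.trans (by gcongr)
    linarith
  have b2 : ‖liftedFlux (mulTop k b)‖ ≤ ‖w‖ * (ρ ^ 3 / 2) := by
    have h1 := norm_liftedFlux_le (mulTop k b)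
    have h2 := norm_mulTop_le k b
    have h3 : ‖k‖ * ‖b‖ ≤ (‖w‖ * (ρ / 2)) * (ρ ^ 2 / 2) := by
      gcongr
      · exact hkn.trans (by nlinarith)
      · exact hbn.trans (by gcongr)
    nlinarith
  have b3 : ‖lifted (roughPart w t) x‖ ≤ ‖w‖ * ((1 + ρ / 2) / 8) * e := by
    refine (norm_lifted_le _ _).trans ?_
    have h1 : ‖roughPart w t‖ ≤ ‖w‖ * (1 + ρ / 2) * e :=
      (norm_roughPart_le ht).trans (by gcongr; nlinarith)
    have h2 : ‖roughPart w t‖ * ‖x‖ ≤ (‖w‖ * (1 + ρ / 2) * e) * (1 / 16) := by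
      gcongr
    linarith
  have s1 : |e * c| ≤ e := by
    rw [abs_mul, abs_of_pos he0]; nlinarith [abs_nonneg c]
  have s2 : |c ^ 2 / 2| ≤ e / 2 := by
    rw [abs_div, abs_pow, abs_two]; nlinarith [abs_nonneg c]
  have m1 : ‖(e * c) • liftedFlux (mulTop w b)‖ ≤ e * (‖w‖ * ρ ^ 2) := by
    rw [norm_smul]; exact mul_le_mul s1 b1 (norm_nonneg _) he0.le
  have m2 : ‖(c ^ 2 / 2) • liftedFlux (mulTop k b)‖ ≤ e / 2 * (‖w‖ * (ρ ^ 3 / 2)) := by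
    rw [norm_smul]; exact mul_le_mul s2 b2 (norm_nonneg _) (by positivity)
  refine (norm_sub_le _ _).trans ?_
  rw [norm_neg]
  have := norm_add_le ((e * c) • liftedFlux (mulTop w b))
    ((c ^ 2 / 2) • liftedFlux (mulTop k b))
  have e3 : (ρ ^ 2 + ρ ^ 3 / 4 + (1 + ρ / 2) / 8) * ‖w‖ * e =
    e * (‖w‖ * ρ ^ 2) + e / 2 * (‖w‖ * (ρ ^ 3 / 2)) + ‖w‖ * ((1 + ρ / 2) / 8) * e := by ring
  linarith

/-- The factor in the bound of the smooth part of the deviation, for `‖φ - φ'‖ ≤ ρ`. -/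
noncomputable def smoothBound (ρ : ℝ) : ℝ :=
  2 * (ρ ^ 2 + ρ ^ 3 / 4 + (1 + ρ / 2) / 8) * Real.exp (2 * (ρ + ρ ^ 2 / 2))

lemma smoothBound_nonneg {ρ : ℝ} (hρ : 0 ≤ ρ) : 0 ≤ smoothBound ρ := by
  unfold smoothBound; positivity

lemma smoothBound_sq (ρ : ℝ) : smoothBound ρ ^ 2 =
    4 * (ρ ^ 2 + ρ ^ 3 / 4 + (1 + ρ / 2) / 8) ^ 2 * Real.exp (2 * (2 * (ρ + ρ ^ 2 / 2))) := by
  have e : Real.exp (2 * (2 * (ρ + ρ ^ 2 / 2))) = Real.exp (2 * (ρ + ρ ^ 2 / 2)) ^ 2 := by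
    rw [← Real.exp_nat_mul]; congr 1
  rw [e, smoothBound]
  ring

/-- The smooth part of the deviation solves a quadratic equation in `L²` with decaying forcing. -/
lemma exists_smoothPart {η : ℝ → L2} (hη : Continuous η) (hη' : ∀ t, ‖η t‖ ≤ 1 / 16)
    {w k : L2} {b : Lp ℝ ∞ (volume : Measure ℝ)} {ρ : ℝ} (hw : ‖w‖ ≤ ρ)
    (hkn : ‖k‖ ≤ ‖w‖ ^ 2 / 2) (hbn : ‖b‖ ≤ ‖w‖ ^ 2 / 2) :
    ∃ z : ℝ → L2, z 0 = 0 ∧ ContinuousOn z (Set.Ici 0) ∧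
      (∀ t, 0 < t → HasDerivAt z (-z t + -((1 / 2 : ℝ) • lifted (resolvent (z t)) (z t)) +
          -lifted (roughPart w t + resolvent (η t)) (z t) +
          (-((Real.exp (-t) * (Real.exp (-(2 * t)) - Real.exp (-t))) • liftedFlux (mulTop w b) +
            ((Real.exp (-(2 * t)) - Real.exp (-t)) ^ 2 / 2) • liftedFlux (mulTop k b)) -
              lifted (roughPart w t) (η t))) t) ∧
      ∀ t, 0 ≤ t → ‖z t‖ ≤ smoothBound ρ * Real.exp (-t / 2) * ‖w‖ := by
  have hρ : 0 ≤ ρ := (norm_nonneg w).trans hw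
  set c : ℝ → ℝ := fun t => Real.exp (-(2 * t)) - Real.exp (-t) with hc
  set Q : L2 →L[ℝ] L2 →L[ℝ] L2 := -((1 / 2 : ℝ) • lifted.comp resolvent) with hQ
  set L : ℝ → L2 →L[ℝ] L2 := fun t => -lifted (roughPart w t + resolvent (η t)) with hL
  set F : ℝ → L2 := fun t =>
    -((Real.exp (-t) * c t) • liftedFlux (mulTop w b) +
      (c t ^ 2 / 2) • liftedFlux (mulTop k b)) - lifted (roughPart w t) (η t) with hF
  have hrc := continuous_roughPart w
  have hQ0 : ∀ x, inner ℝ x (Q x x) = 0 := fun x => by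
    have e : Q x x = (-(1 / 2) : ℝ) • lifted (resolvent x) x := by
      simp [hQ]
    rw [e, real_inner_smul_right, inner_lifted_self, mul_zero]
  have hLc : Continuous L := by simp only [hL]; fun_prop
  have hFc : Continuous F := by simp only [hF, hc]; fun_prop
  have hLb : ∀ t, 0 ≤ t → ‖L t‖ ≤ 1 / 4 + 2 * (ρ + ρ ^ 2 / 2) * Real.exp (-t) := fun t ht => by
    have h1 : ‖roughPart w t‖ ≤ (ρ + ρ ^ 2 / 2) * Real.exp (-t) :=
      (norm_roughPart_le ht).trans (by gcongr)
    refine ContinuousLinearMap.opNorm_le_bound _ (by positivity) fun x => ?_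
    have h2 : ‖roughPart w t + resolvent (η t)‖ ≤ (ρ + ρ ^ 2 / 2) * Real.exp (-t) + 1 / 16 :=
      (norm_add_le _ _).trans (add_le_add h1 ((norm_resolvent_le _).trans (hη' t)))
    simp only [hL, _root_.neg_apply, norm_neg]
    refine (norm_lifted_le _ _).trans ?_
    have h3 := mul_le_mul_of_nonneg_right h2 (norm_nonneg x)
    nlinarith [norm_nonneg x]
  set K : ℝ := ρ ^ 2 + ρ ^ 3 / 4 + (1 + ρ / 2) / 8 with hK
  have hK0 : 0 ≤ K := by positivity
  have hFb : ∀ t, 0 ≤ t → ‖F t‖ ≤ K * ‖w‖ * Real.exp (-t) := fun t ht =>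
    norm_forcing_le hw hkn hbn (hη' t) ht
  obtain ⟨z, hz0, hzc, hzd, hzb⟩ := exists_decaying_solution hQ0 hLc hFc
    (c := 2 * (ρ + ρ ^ 2 / 2)) (D := K * ‖w‖) (by positivity) (by positivity) hLb hFb
  refine ⟨z, hz0, hzc, fun t ht => ?_, fun t ht => ?_⟩
  · refine (hzd t ht).congr_deriv ?_
    have q : Q (z t) (z t) = -((1 / 2 : ℝ) • lifted (resolvent (z t)) (z t)) := by simp [hQ]
    rw [quadField, q]; simp only [hL, hF, hc, _root_.neg_apply]
  · refine (pow_le_pow_iff_left₀ (norm_nonneg _) (mul_nonneg (mul_nonneg (smoothBound_nonneg hρ)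
      (Real.exp_pos _).le) (norm_nonneg _)) two_ne_zero).1 ((hzb t ht).trans ?_)
    rw [mul_pow K, mul_pow (_ * _) ‖w‖, mul_pow (smoothBound ρ), smoothBound_sq]
    have e1 : Real.exp (-t / 2) ^ 2 = Real.exp (-t) := by
      rw [← Real.exp_nat_mul]; congr 1; push_cast; ring
    rw [e1, ← hK]
    have : 0 ≤ K ^ 2 * ‖w‖ ^ 2 * Real.exp (2 * (2 * (ρ + ρ ^ 2 / 2))) * Real.exp (-t) := by
      positivity
    nlinarith

/-- The solution with datum `u'(0) + w` is `u' + roughPart w + (1 + ∂)⁻¹ z`, where `z` solves a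
quadratic equation in `L²` whose forcing decays: subtracting `roughPart w` removes the term
`e^{-2t} ∂(1 - ∂²)⁻¹(w²/2)`, the only quadratic term that need not lie in `H¹`. -/
lemma exists_isMild_of_datum {f η : ℝ → L2} (hf : ∀ t, 0 ≤ t → IntervalIntegrable f volume 0 t)
    (hη : Continuous η) (hη' : ∀ t, ‖η t‖ ≤ 1 / 16) (hm : IsMild f fun t => resolvent (η t))
    {w : L2} {ρ : ℝ} (hw : ‖w‖ ≤ ρ) :
    ∃ z : ℝ → L2, z 0 = 0 ∧ ContinuousOn z (Set.Ici 0) ∧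
      (∀ t, 0 ≤ t → ‖z t‖ ≤ smoothBound ρ * Real.exp (-t / 2) * ‖w‖) ∧
      IsMild f fun t => resolvent (η t) + (roughPart w t + resolvent (z t)) := by
  obtain ⟨b, hb, hbn⟩ := exists_bilin_ae_eq_top w
  set k : L2 := (1 / 2 : ℝ) • bilin w w with hk
  obtain ⟨z, hz0, hzc, hzd, hzb⟩ := exists_smoothPart hη hη' hw (norm_half_bilin_self_le w) hbn
  have hrc := continuous_roughPart w
  have hum : ContinuousOn (fun t => resolvent (η t) + (roughPart w t + resolvent (z t)))
      (Set.Ici 0) := by fun_prop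
  refine ⟨z, hz0, hzc, hzb, hum, fun t ht => ?_⟩
  set y : ℝ → L2 := fun t => roughPart w t + resolvent (z t) with hy
  have hyd : ∀ s, 0 < s → HasDerivAt y
      (rhs (resolvent (η s) + y s) (f s) - rhs (resolvent (η s)) (f s)) s := fun s hs => by
    have h0 := resolvent.hasFDerivAt.comp_hasDerivAt s (hzd s hs)
    rw [resolvent_smoothField (f s) hb (by rw [hk, smul_smul]; norm_num)
      (show roughPart w s = _ from rfl)] at h0
    have h3 : Real.exp (-(2 * s)) = Real.exp (-s) ^ 2 := by
      rw [← Real.exp_nat_mul]; congr 1; push_cast; ring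
    have h1 : HasDerivAt y _ s := (hasDerivAt_roughPart w s).add h0
    refine h1.congr_deriv ?_
    rw [← hk, h3, add_sub_cancel]
  have hi1 := IsMild.intervalIntegrable_rhs hf hum ht
  have hi2 := IsMild.intervalIntegrable_rhs hf hm.cont ht
  have hyc : ContinuousOn y (Set.Icc 0 t) :=
    (show ContinuousOn y (Set.Ici 0) by fun_prop).mono Set.Icc_subset_Ici_self
  have h1 := intervalIntegral.integral_eq_sub_of_hasDerivAt_of_le ht hyc
    (fun s hs => hyd s hs.1) (hi1.sub hi2)
  rw [intervalIntegral.integral_sub hi1 hi2, sub_eq_iff_eq_add] at h1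
  have h2 := hm.eq t ht
  rw [h1, h2]
  simp only [hy]
  abel

/-! ### Stability in Sobolev norms -/

section

variable {ℓ : ℝ}

lemma sobolevNorm_half_bilin_le (h0 : 0 ≤ ℓ) (h1 : ℓ ≤ 1) (w : L2) :
    sobolevNorm ℓ ((1 / 2 : ℝ) • bilin w w) ≤ ENNReal.ofReal (4 * ‖w‖) * sobolevNorm ℓ w := by
  have e : ENNReal.ofReal (4 * ‖w‖) = ‖(1 / 2 : ℝ)‖ₑ * (8 * ‖w‖ₑ) := by
    rw [← ofReal_norm w, ← ofReal_norm (1 / 2 : ℝ),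
      show (8 : ℝ≥0∞) = ENNReal.ofReal 8 by norm_num, ← ENNReal.ofReal_mul (by norm_num),
      ← ENNReal.ofReal_mul (by positivity)]
    congr 1
    rw [Real.norm_of_nonneg (by norm_num)]
    ring
  rw [sobolevNorm_smul, e, mul_assoc]
  gcongr
  refine (sobolevNorm_bilin_self_le h0 h1 w).trans (le_of_eq ?_)
  ring

lemma MemH.half_bilin (h0 : 0 ≤ ℓ) (h1 : ℓ ≤ 1) {w : L2} (hw : MemH ℓ w) :
    MemH ℓ ((1 / 2 : ℝ) • bilin w w) :=
  (sobolevNorm_half_bilin_le h0 h1 w).trans_lt (ENNReal.mul_lt_top ENNReal.ofReal_lt_top hw)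

lemma MemH.add {g h : L2} (hg : MemH ℓ g) (hh : MemH ℓ h) : MemH ℓ (g + h) :=
  (sobolevNorm_add_le ℓ g h).trans_lt (ENNReal.add_lt_top.2 ⟨hg, hh⟩)

lemma MemH.smul {g : L2} (hg : MemH ℓ g) (c : ℝ) : MemH ℓ (c • g) := by
  rw [MemH, sobolevNorm_smul]
  exact ENNReal.mul_lt_top (by simp) hg

lemma memH_resolvent (h1 : ℓ ≤ 1) (z : L2) : MemH ℓ (resolvent z) :=
  (sobolevNorm_resolvent_le h1 z).trans_lt (by simp)

lemma memH_roughPart (h0 : 0 ≤ ℓ) (h1 : ℓ ≤ 1) {w : L2} (hw : MemH ℓ w) (t : ℝ) :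
    MemH ℓ (roughPart w t) :=
  (hw.smul _).add ((hw.half_bilin h0 h1).smul _)

lemma tendsto_sobolevNorm_add {X : Type*} {l : Filter X} {g h : X → L2}
    (hg : Tendsto (fun x => sobolevNorm ℓ (g x)) l (𝓝 0))
    (hh : Tendsto (fun x => sobolevNorm ℓ (h x)) l (𝓝 0)) :
    Tendsto (fun x => sobolevNorm ℓ (g x + h x)) l (𝓝 0) :=
  tendsto_of_tendsto_of_tendsto_of_le_of_le tendsto_const_nhds
    (by simpa using hg.add hh) (fun _ => zero_le) fun _ => sobolevNorm_add_le _ _ _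

lemma tendsto_sobolevNorm_smul_sub {c : ℝ → ℝ} (hc : Continuous c) {g : L2} (hg : MemH ℓ g)
    (s : Set ℝ) (t₀ : ℝ) :
    Tendsto (fun t => sobolevNorm ℓ ((c t - c t₀) • g)) (𝓝[s] t₀) (𝓝 0) := by
  simp only [sobolevNorm_smul]
  have h : Tendsto (fun t => ‖c t - c t₀‖ₑ) (𝓝[s] t₀) (𝓝 0) := by
    have : Continuous fun t => ‖c t - c t₀‖ₑ := by fun_prop
    simpa using (this.tendsto t₀).mono_left nhdsWithin_le_nhds
  simpa using ENNReal.Tendsto.mul_const h (Or.inr (ne_of_lt hg))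

lemma tendsto_sobolevNorm_resolvent_sub (h1 : ℓ ≤ 1) {z : ℝ → L2} {s : Set ℝ}
    (hz : ContinuousOn z s) {t₀ : ℝ} (ht : t₀ ∈ s) :
    Tendsto (fun t => sobolevNorm ℓ (resolvent (z t - z t₀))) (𝓝[s] t₀) (𝓝 0) := by
  have h := tendsto_iff_edist_tendsto_0.1 (hz t₀ ht)
  simp only [edist_eq_enorm_sub] at h
  exact tendsto_of_tendsto_of_tendsto_of_le_of_le tendsto_const_nhds h (fun _ => zero_le)
    fun _ => sobolevNorm_resolvent_le h1 _

lemma tendsto_sobolevNorm_roughPart_sub (h0 : 0 ≤ ℓ) (h1 : ℓ ≤ 1) {w : L2} (hw : MemH ℓ w)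
    (s : Set ℝ) (t₀ : ℝ) :
    Tendsto (fun t => sobolevNorm ℓ (roughPart w t - roughPart w t₀)) (𝓝[s] t₀) (𝓝 0) := by
  have e : ∀ t, roughPart w t - roughPart w t₀ = (Real.exp (-t) - Real.exp (-t₀)) • w +
      (Real.exp (-(2 * t)) - Real.exp (-t) - (Real.exp (-(2 * t₀)) - Real.exp (-t₀))) •
        ((1 / 2 : ℝ) • bilin w w) := fun t => by
    simp only [roughPart]; module
  simp only [e]
  exact tendsto_sobolevNorm_add
    (tendsto_sobolevNorm_smul_sub (c := fun t => Real.exp (-t)) (by fun_prop) hw s t₀)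
    (tendsto_sobolevNorm_smul_sub (c := fun t => Real.exp (-(2 * t)) - Real.exp (-t))
      (by fun_prop) (hw.half_bilin h0 h1) s t₀)

lemma sobolevNorm_roughPart_le (h0 : 0 ≤ ℓ) (h1 : ℓ ≤ 1) (w : L2) {t : ℝ} (ht : 0 ≤ t) :
    sobolevNorm ℓ (roughPart w t) ≤
      ENNReal.ofReal ((1 + 4 * ‖w‖) * Real.exp (-t)) * sobolevNorm ℓ w := by
  have b1 : sobolevNorm ℓ (Real.exp (-t) • w) =
      ENNReal.ofReal (Real.exp (-t)) * sobolevNorm ℓ w := by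
    rw [sobolevNorm_smul, ← ofReal_norm, Real.norm_of_nonneg (Real.exp_pos _).le]
  have b2 : sobolevNorm ℓ ((Real.exp (-(2 * t)) - Real.exp (-t)) • ((1 / 2 : ℝ) • bilin w w)) ≤
      ENNReal.ofReal (Real.exp (-t)) * (ENNReal.ofReal (4 * ‖w‖) * sobolevNorm ℓ w) := by
    rw [sobolevNorm_smul, ← ofReal_norm]
    exact mul_le_mul' (ENNReal.ofReal_le_ofReal (abs_exp_sub_exp_le ht))
      (sobolevNorm_half_bilin_le h0 h1 w)
  refine (sobolevNorm_add_le _ _ _).trans ((add_le_add b1.le b2).trans (le_of_eq ?_))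
  rw [← mul_assoc, ← add_mul, ← ENNReal.ofReal_mul (Real.exp_pos _).le,
    ← ENNReal.ofReal_add (Real.exp_pos _).le (by positivity)]
  congr 2
  ring

/-- The constant in the exponential estimate for data at distance at most `ρ` from the datum of
the periodic solution. -/
noncomputable def stabilityConst (ρ : ℝ) : ℝ := 1 + 4 * ρ + smoothBound ρ

lemma stabilityConst_pos {ρ : ℝ} (hρ : 0 ≤ ρ) : 0 < stabilityConst ρ := by
  have := smoothBound_nonneg hρ
  unfold stabilityConst
  positivity

variable {f η : ℝ → L2}

lemma isSolution_resolvent (h1 : ℓ ≤ 1) (hf : ∀ t, 0 ≤ t → IntervalIntegrable f volume 0 t)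
    (hη : Continuous η) (hm : IsMild f fun t => resolvent (η t)) :
    IsSolution ℓ f (resolvent (η 0)) fun t => resolvent (η t) :=
  hm.isSolution hf (fun t _ => memH_resolvent h1 _) fun t₀ ht₀ => by
    simpa only [map_sub] using
      tendsto_sobolevNorm_resolvent_sub h1 hη.continuousOn (Set.mem_Ici.2 ht₀)

lemma IsSolution.generates (h0 : 0 ≤ ℓ) (hf : ∀ t, 0 ≤ t → IntervalIntegrable f volume 0 t)
    {φ : L2} {u : ℝ → L2} (hu : IsSolution ℓ f φ u) : Generates ℓ f φ u :=
  ⟨hu, fun _ hv _ ht => (hv.isMild h0 hf).unique hf (hu.isMild h0 hf)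
    (hv.init.trans hu.init.symm) ht⟩

/-- Well-posedness and exponential stability, with constants that depend only on a bound for the
`L²` distance of the initial data. -/
lemma exists_generates_sobolevNorm_sub_le (h0 : 0 ≤ ℓ) (h1 : ℓ ≤ 1)
    (hf : ∀ t, 0 ≤ t → IntervalIntegrable f volume 0 t) (hη : Continuous η)
    (hη' : ∀ t, ‖η t‖ ≤ 1 / 16) (hm : IsMild f fun t => resolvent (η t)) {φ : L2} {ρ : ℝ}
    (hφ : MemH ℓ φ) (hρ : ‖φ - resolvent (η 0)‖ ≤ ρ) :
    ∃ u, Generates ℓ f φ u ∧ ∀ t, 0 ≤ t → sobolevNorm ℓ (u t - resolvent (η t)) ≤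
      ENNReal.ofReal (stabilityConst ρ * Real.exp (-t / 2)) *
        sobolevNorm ℓ (φ - resolvent (η 0)) := by
  set w := φ - resolvent (η 0) with hw
  have hwm : MemH ℓ w :=
    (sobolevNorm_sub_le _ _ _).trans_lt (ENNReal.add_lt_top.2 ⟨hφ, memH_resolvent h1 _⟩)
  obtain ⟨z, hz0, hzc, hzb, hmild⟩ := exists_isMild_of_datum hf hη hη' hm hρ
  have hρ0 : 0 ≤ ρ := (norm_nonneg _).trans hρ
  have hsol := hmild.isSolution (ℓ := ℓ) hf
    (fun t _ => (memH_resolvent h1 _).add ((memH_roughPart h0 h1 hwm t).add (memH_resolvent h1 _)))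
    fun t₀ ht₀ => by
      have e : ∀ t, resolvent (η t) + (roughPart w t + resolvent (z t)) -
          (resolvent (η t₀) + (roughPart w t₀ + resolvent (z t₀))) = resolvent (η t - η t₀) +
            ((roughPart w t - roughPart w t₀) + resolvent (z t - z t₀)) := fun t => by
        simp only [map_sub]; abel
      simp only [e]
      exact tendsto_sobolevNorm_add
        (tendsto_sobolevNorm_resolvent_sub h1 hη.continuousOn (Set.mem_Ici.2 ht₀))
        (tendsto_sobolevNorm_add (tendsto_sobolevNorm_roughPart_sub h0 h1 hwm _ _)
          (tendsto_sobolevNorm_resolvent_sub h1 hzc (Set.mem_Ici.2 ht₀)))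
  have hinit : resolvent (η 0) + (roughPart w 0 + resolvent (z 0)) = φ := by
    rw [roughPart_zero, hz0, map_zero, add_zero, hw, add_sub_cancel]
  rw [hinit] at hsol
  refine ⟨_, hsol.generates h0 hf, fun t ht => ?_⟩
  rw [add_sub_cancel_left]
  have b1 : sobolevNorm ℓ (roughPart w t) ≤
      ENNReal.ofReal ((1 + 4 * ρ) * Real.exp (-t / 2)) * sobolevNorm ℓ w := by
    refine (sobolevNorm_roughPart_le h0 h1 w ht).trans ?_
    gcongr
    linarith
  have b2 : sobolevNorm ℓ (resolvent (z t)) ≤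
      ENNReal.ofReal (smoothBound ρ * Real.exp (-t / 2)) * sobolevNorm ℓ w := by
    refine (sobolevNorm_resolvent_le h1 _).trans ?_
    rw [← ofReal_norm]
    refine (ENNReal.ofReal_le_ofReal (hzb t ht)).trans ?_
    rw [ENNReal.ofReal_mul (mul_nonneg (smoothBound_nonneg hρ0) (Real.exp_pos _).le),
      ofReal_norm]
    gcongr
    exact enorm_le_sobolevNorm h0 w
  refine (sobolevNorm_add_le _ _ _).trans ((add_le_add b1 b2).trans (le_of_eq ?_))
  rw [← add_mul, ← ENNReal.ofReal_add (by positivity)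
    (mul_nonneg (smoothBound_nonneg hρ0) (Real.exp_pos _).le), ← add_mul]
  rfl

end

/-! ### Periodicity -/

lemma PeriodicOnNonneg.add_nat_mul {θ : ℝ} (hθ : 0 < θ) {g : ℝ → L2} (h : PeriodicOnNonneg θ g)
    {t : ℝ} (ht : 0 ≤ t) (n : ℕ) : g (t + n * θ) = g t := by
  induction n with
  | zero => simp
  | succ n ih =>
    rw [← ih, ← h (t + n * θ) (by positivity)]
    congr 1
    push_cast
    ring

/-- A solution that takes its initial value again at time `θ`, a period of the forcing, is
periodic. -/
lemma IsMild.periodicOnNonneg {θ : ℝ} (hθ : 0 < θ) {f u : ℝ → L2}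
    (hf : ∀ t, 0 ≤ t → IntervalIntegrable f volume 0 t) (hfp : PeriodicOnNonneg θ f)
    (hu : IsMild f u) (h : u θ = u 0) : PeriodicOnNonneg θ u := fun t ht => by
  have hv : IsMild f fun t => u (t + θ) := by
    refine ⟨hu.cont.comp (by fun_prop) fun t (ht : 0 ≤ t) => Set.mem_Ici.2 (by positivity),
      fun t ht => ?_⟩
    have i1 := IsMild.intervalIntegrable_rhs hf hu.cont hθ.le
    have i2 := IsMild.intervalIntegrable_rhs hf hu.cont (add_nonneg ht hθ.le)
    have h1 := hu.eq (t + θ) (by positivity)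
    have h2 := hu.eq θ hθ.le
    rw [← intervalIntegral.integral_add_adjacent_intervals i1 (i1.symm.trans i2), ← add_assoc,
      ← h2] at h1
    have h3 : ∫ s in θ..t + θ, rhs (u s) (f s) = ∫ s in (0 : ℝ)..t, rhs (u (s + θ)) (f s) := by
      have := intervalIntegral.integral_comp_add_right (a := 0) (b := t)
        (fun s => rhs (u s) (f s)) θ
      rw [zero_add] at this
      rw [← this]
      refine intervalIntegral.integral_congr fun s hs => ?_
      rw [Set.uIcc_of_le ht] at hs
      simp only [hfp s hs.1]
    simp only [h1, h3, zero_add]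
  exact hv.unique hf hu (by simpa using h) ht

/-- The exponential decay of deviations forces every periodic solution to be the periodic
solution `u'` of the stability estimate. -/
lemma eq_of_periodicOnNonneg {ℓ : ℝ} (h0 : 0 ≤ ℓ) {θ : ℝ} (hθ : 0 < θ) {u v : ℝ → L2}
    (hu : PeriodicOnNonneg θ u) (hv : PeriodicOnNonneg θ v) {C : ℝ} {S : ℝ≥0∞} (hS : S ≠ ∞)
    (h : ∀ t, 0 ≤ t → sobolevNorm ℓ (v t - u t) ≤ ENNReal.ofReal (C * Real.exp (-t / 2)) * S)
    {t : ℝ} (ht : 0 ≤ t) : v t = u t := by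
  have hlim : Tendsto (fun n : ℕ => ENNReal.ofReal (C * Real.exp (-(t + n * θ) / 2)) * S) atTop
      (𝓝 0) := by
    have l0 : Tendsto (fun n : ℕ => t + n * θ) atTop atTop :=
      tendsto_atTop_add_const_left _ _ (tendsto_natCast_atTop_atTop.atTop_mul_const hθ)
    have l1 : Tendsto (fun n : ℕ => -(t + n * θ) / 2) atTop atBot :=
      (tendsto_neg_atTop_atBot.comp l0).atBot_div_const two_pos
    have l2 := ENNReal.tendsto_ofReal ((Real.tendsto_exp_atBot.comp l1).const_mul C)
    simpa using ENNReal.Tendsto.mul_const l2 (Or.inr hS)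
  have hle : ‖v t - u t‖ₑ ≤ 0 := ge_of_tendsto' hlim fun n => by
    have h2 := h (t + n * θ) (by positivity)
    rw [hu.add_nat_mul hθ ht, hv.add_nat_mul hθ ht] at h2
    exact (enorm_le_sobolevNorm h0 _).trans h2
  exact sub_eq_zero.1 (by simpa using hle)

end BBM

theorem theorem2p2 (ℓ : ℝ) (hℓ₀ : 0 ≤ ℓ) (hℓ₁ : ℓ < 1) :
    ∃ δ > (0 : ℝ), ∃ γ₀ > (0 : ℝ), ∃ r > (0 : ℝ), ∃ C₀ > (0 : ℝ), ∃ γ₁ C₁ : ℝ → ℝ,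
      (∀ R > (0 : ℝ), 0 < γ₁ R ∧ 0 < C₁ R) ∧
      ∀ θ > (0 : ℝ), ∀ f : ℝ → BBM.L2,
        AEStronglyMeasurable f (volume.restrict (Set.Ici (0 : ℝ))) →
        (∀ t : ℝ, 0 ≤ t → ‖f t‖ ≤ δ) →
        BBM.PeriodicOnNonneg θ f →
        ∃ (φ' : BBM.L2) (u' : ℝ → BBM.L2),
          -- the datum `φ'` in `H^ℓ` generates the periodic solution `u'`
          BBM.MemH ℓ φ' ∧ BBM.Generates ℓ f φ' u' ∧ BBM.PeriodicOnNonneg θ u' ∧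
          -- uniqueness among all periodic solutions
          (∀ (φ : BBM.L2) (v : ℝ → BBM.L2), BBM.IsSolution ℓ f φ v → BBM.PeriodicOnNonneg θ v →
            ∀ t : ℝ, 0 ≤ t → v t = u' t) ∧
          -- local exponential stability
          (∀ φ : BBM.L2, BBM.sobolevNorm ℓ (φ - φ') ≤ ENNReal.ofReal r →
            ∃ u : ℝ → BBM.L2, BBM.Generates ℓ f φ u ∧
              ∀ t : ℝ, 0 ≤ t → BBM.sobolevNorm ℓ (u t - u' t) ≤
                ENNReal.ofReal (C₀ * Real.exp (-(2 * γ₀ * t))) * BBM.sobolevNorm ℓ (φ - φ')) ∧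
          -- global exponential stability
          (∀ R > (0 : ℝ), ∀ φ : BBM.L2, BBM.sobolevNorm ℓ φ ≤ ENNReal.ofReal R →
            ∃ u : ℝ → BBM.L2, BBM.Generates ℓ f φ u ∧
              ∀ t : ℝ, 0 ≤ t → BBM.sobolevNorm ℓ (u t - u' t) ≤
                ENNReal.ofReal (C₁ R * Real.exp (-(2 * γ₁ R * t))) *
                  BBM.sobolevNorm ℓ (φ - φ')) := by
  refine ⟨1 / 32, by norm_num, 1 / 4, by norm_num, 1, one_pos, BBM.stabilityConst 1,
    BBM.stabilityConst_pos one_pos.le, fun _ => 1 / 4, fun R => BBM.stabilityConst (R + 1),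
    fun R hR => ⟨by norm_num, BBM.stabilityConst_pos (by positivity)⟩, fun θ hθ f hfm hfb hfp => ?_⟩
  have hf : ∀ t, 0 ≤ t → IntervalIntegrable f volume 0 t := fun t ht =>
    BBM.intervalIntegrable_of_bounded hfm hfb le_rfl ht
  obtain ⟨η, hη, hη', hper, hm⟩ := BBM.exists_isMild_periodic hθ hfm hfb
  have hu' : BBM.PeriodicOnNonneg θ fun t => BBM.resolvent (η t) :=
    hm.periodicOnNonneg hθ hf hfp (by simp only [hper])
  have hφ' : BBM.MemH ℓ (BBM.resolvent (η 0)) := BBM.memH_resolvent hℓ₁.le _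
  -- the rate `e^{-t/2}` comes from the bound `‖z t‖² = O(e^{-t})` on the smooth part
  have hrate : ∀ t : ℝ, -(2 * (1 / 4) * t) = -t / 2 := fun t => by ring
  refine ⟨BBM.resolvent (η 0), fun t => BBM.resolvent (η t), hφ',
    (BBM.isSolution_resolvent hℓ₁.le hf hη hm).generates hℓ₀ hf, hu', fun φ v hv hvp t ht => ?_,
    fun φ hφ => ?_, fun R hR φ hφ => ?_⟩
  · have hφ : BBM.MemH ℓ φ := hv.init ▸ hv.memH 0 le_rfl
    obtain ⟨u, hu, hub⟩ :=
      BBM.exists_generates_sobolevNorm_sub_le hℓ₀ hℓ₁.le hf hη hη' hm hφ le_rfl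
    refine BBM.eq_of_periodicOnNonneg (C := BBM.stabilityConst ‖φ - BBM.resolvent (η 0)‖) hℓ₀ hθ
      hu' hvp
      (((BBM.sobolevNorm_sub_le _ _ _).trans_lt (ENNReal.add_lt_top.2 ⟨hφ, hφ'⟩)).ne)
      (fun s hs => ?_) ht
    rw [hu.2 v hv s hs]
    exact hub s hs
  · have hd : ‖φ - BBM.resolvent (η 0)‖ ≤ 1 := by
      have := (BBM.enorm_le_sobolevNorm hℓ₀ _).trans hφ
      rwa [← ofReal_norm, ENNReal.ofReal_le_ofReal_iff one_pos.le] at this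
    have hφm : BBM.MemH ℓ φ := by
      have h : BBM.MemH ℓ (φ - BBM.resolvent (η 0)) := hφ.trans_lt ENNReal.ofReal_lt_top
      simpa using h.add hφ'
    simp only [hrate]
    exact BBM.exists_generates_sobolevNorm_sub_le hℓ₀ hℓ₁.le hf hη hη' hm hφm hd
  · have hd : ‖φ - BBM.resolvent (η 0)‖ ≤ R + 1 := by
      have h1 := (BBM.enorm_le_sobolevNorm hℓ₀ _).trans hφ
      rw [← ofReal_norm, ENNReal.ofReal_le_ofReal_iff hR.le] at h1
      have h2 := (BBM.norm_resolvent_le (η 0)).trans (hη' 0)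
      linarith [norm_sub_le φ (BBM.resolvent (η 0))]
    simp only [hrate]
    exact BBM.exists_generates_sobolevNorm_sub_le hℓ₀ hℓ₁.le hf hη hη' hm
      (hφ.trans_lt ENNReal.ofReal_lt_top) hd
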